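/- **Setting.** Write $[\ln\ln]_+(x)=\ln\ln\max\{x,e^e\}$. Let $\theta^*\in[0,1]$ and let a labeler answer each query at $x\in[0,1]$ by a response $Y\in\{0,1,\perp\}$ drawn from $P(\cdot\mid x)$, the responses to different queries being independent given the query points. Assume: 1. (Condition 1) for $x,x'\in[0,1]$ with $|x-\theta^*|\ge|x'-\theta^*|$ one has $P(\perp\mid x)\le P(\perp\mid x')$; and $P(Y\ne\mathbb 1[x>\theta^*]\mid x,\,Y\neq\perp)\le\frac12$ for every $x\in[0,1]$ with $P(\perp\mid x)<1$; 2. (Condition 3) $P(\perp\mid x)=1-f(|x-\theta^*|)$ for $x\in[0,1]$, where $f:[0,1]\to[0,1]$ is nondecreasing, $f>0$ on $(0,1]$, and for some $c\in(0,1)$ one has $f(b)/f(a)\le 1-c$ whenever $0<a\le1$ and $0\le b\le\frac23a$. **Test functions.** For an array $X=(X_1,\dots,X_n)$ and $\delta'\in(0,1)$ put $S_n=\sum_i X_i$, $V_n=\frac{n}{n-1}\left(\sum_iX_i^2-\frac1n S_n^2\right)$ (with $V_1=0$), $$p(n,\delta')=D_0\Big(1+\ln\tfrac1{\delta'}+\sqrt{4n([\ln\ln]_+(4n)+\ln\tfrac1{\delta'})}\Big),$$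 $$q(V,\delta')=D_1\Big(1+\ln\tfrac1{\delta'}+\sqrt{(V+\ln\tfrac1{\delta'}+1)([\ln\ln]_+(V+\ln\tfrac1{\delta'}+1)+\ln\tfrac1{\delta'})}\Big).$$ CheckSignificant$(X,\delta')$ holds iff $S_n\ge p(n,\delta')$; CheckSignificant-Var$(X,\delta')$ holds iff $n\ge\ln\frac1{\delta'}$ and $S_n\ge q(V_n,\delta')$. Here $D_0,D_1$ are absolute constants such that for all i.i.d. sequences $X_1,X_2,\dots$ with values in $[-2,2]$ and mean $0$ and all $\delta'\in(0,1)$: with probability at least $1-\delta'$, $|S_n|\le p(n,\delta')$ for all $n\geq 1$; and with probability at least $1-\delta'$, $|S_n|\le q(V_n,\delta')$ for all $n\ge1$ with $n\ge\ln\frac1{\delta'}$. **Algorithm 1.** Input $\delta\in(0,1)$ and $\epsilon>0$ such that $K=\log_{4/3}\frac1{2\epsilon}$ is a nonnegative integer. Put $[L_0,R_0]=[0,1]$ and $\delta'=\delta/(4K)$. For $k=0,\dots,K-1$ let $U=\frac{3L_k+R_k}4$, $M=\frac{L_k+R_k}2$, $V=\frac{L_k+3R_k}4$. For $n=1,2,\dots$: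 query once at each of $U,M,V$. Let $A^{(w)}_i$ be $1$ if the $i$-th response at point $w$ in this round is not $\perp$ and $0$ otherwise, and let $B^{(w)}$ be the array of the labels received at $w$ so far in this round, coded as $\pm1$ (label $1$ as $+1$, label $0$ as $-1$; abstentions are skipped). Perform in this order, all at level $\delta'$, the tests CheckSignificant-Var on $(A^{(U)}_i-A^{(M)}_i)_{i\le n}$, CheckSignificant-Var on $(A^{(V)}_i-A^{(M)}_i)_{i\le n}$, CheckSignificant on $-B^{(U)}$, CheckSignificant on $B^{(V)}$. At the first success set $[L_{k+1},R_{k+1}]$ to $[U,R_k]$ (first and third test) or $[L_k,V]$ (second and fourth test) and end the round. After round $K-1$ output $\hat\theta=(L_K+R_K)/2$. **Theorem.** Absolute constants $D_0$ and $D_1$ as above exist. For every choice of them and every $c\in(0,1)$ there is a constant $C>0$, depending only on $D_0,D_1,c$, such that for all $\theta^*$, $f$ and all labelers satisfying Conditions 1 and 3 (the latter with this $c$), and for all $\epsilon,\delta$ as above, with probability at least $1-\delta$ Algorithm 1 halts, its output satisfies $|\hat\theta-\theta^*|\le\epsilon$, and its number of queries is at most $$C\cdot\frac1{f(\epsilon/2)}\cdot\ln\frac1\epsilon\cdot\Big(\ln\frac1\delta+[\ln\ln]_+\frac1\epsilon\Big)=\tilde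 O\Big(\frac1{f(\epsilon/2)}\Big).$$ In particular the bound does not involve the rate at which labels are flipped. The same holds, with the same $C$, for the variant of Algorithm 1 that disregards the 0/1 labels (the two CheckSignificant tests are left out, and only the abstention responses are used, through CheckSignificant-Var). -/

import Mathlib

open MeasureTheory ProbabilityTheory Set

namespace AbstainingLabeler

noncomputable section

/-- Responses of the labeler: `none` is the abstention `⊥`, `some true` is the label `1` and
`some false` is the label `0`. -/
abbrev Response : Type := Option Bool

instance instMeasurableSpaceResponse : MeasurableSpace Response := ⊤

/-- A labeler assigns to each point `x` a distribution `P(Y = · | X = x)` of responses. Only the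
values at points of `[0, 1]` matter. -/
abbrev Labeler : Type := ℝ → PMF Response

/-- The ground-truth label `1[x > θ]` of `x`. -/
def trueLabel (θ x : ℝ) : Response := some (@decide (θ < x) (Classical.dec _))

/-- The abstention rate does not increase with the distance to the threshold `θ`, and a label that
is given is wrong with (conditional) probability at most `1/2`. When the labeler abstains at `x`
almost surely, the conditional measure is zero and the second clause is void at `x`. -/
structure MonotoneAbstention (P : Labeler) (θ : ℝ) : Prop where
  abstention : ∀ x ∈ Icc (0 : ℝ) 1, ∀ x' ∈ Icc (0 : ℝ) 1,
    |x' - θ| ≤ |x - θ| → P x none ≤ P x' none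
  noise : ∀ x ∈ Icc (0 : ℝ) 1,
    (ProbabilityTheory.cond (P x).toMeasure {y | y ≠ none}) {y | y ≠ trueLabel θ x} ≤ 1 / 2

/-- `f : [0, 1] → [0, 1]` is nondecreasing and `f b / f a ≤ 1 - c` whenever `0 < a ≤ 1` and
`0 ≤ b ≤ 2 a / 3` (the quotient being meaningful, that is, `f a > 0`). -/
structure NotTooFlat (c : ℝ) (f : ℝ → ℝ) : Prop where
  mapsTo : MapsTo f (Icc 0 1) (Icc 0 1)
  monotone : MonotoneOn f (Icc 0 1)
  pos : ∀ a, 0 < a → a ≤ 1 → 0 < f a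
  ratio : ∀ a, 0 < a → a ≤ 1 → ∀ b, 0 ≤ b → b ≤ 2 / 3 * a → f b / f a ≤ 1 - c

/-- The abstention rate at `x` is `1 - f |x - θ|`. -/
def AbstentionRate (P : Labeler) (f : ℝ → ℝ) (θ : ℝ) : Prop :=
  ∀ x ∈ Icc (0 : ℝ) 1, (P x none).toReal = 1 - f |x - θ|

/-- `[ln ln]₊ x = ln ln max {x, e ^ e}`. -/
def lnlnPlus (x : ℝ) : ℝ := Real.log (Real.log (max x (Real.exp (Real.exp 1))))

/-- The threshold `p(n, δ)`. -/
def pThreshold (D₀ : ℝ) (n : ℕ) (δ : ℝ) : ℝ :=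
  D₀ * (1 + Real.log (1 / δ) + Real.sqrt (4 * n * (lnlnPlus (4 * n) + Real.log (1 / δ))))

/-- The threshold `q(Var, δ)`. -/
def qThreshold (D₁ v δ : ℝ) : ℝ :=
  D₁ * (1 + Real.log (1 / δ) +
    Real.sqrt ((v + Real.log (1 / δ) + 1) *
      (lnlnPlus (v + Real.log (1 / δ) + 1) + Real.log (1 / δ))))

/-- The empirical variance `n / (n - 1) * (∑ Xᵢ² - (∑ Xᵢ)² / n)` of an array of length `n`. -/
def empVar (X : List ℝ) : ℝ :=
  (X.length : ℝ) / ((X.length : ℝ) - 1) * ((X.map (fun x => x ^ 2)).sum - X.sum ^ 2 / X.length)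

/-- `CheckSignificant (X, δ)`. -/
def CheckSignificant (D₀ : ℝ) (X : List ℝ) (δ : ℝ) : Prop :=
  pThreshold D₀ X.length δ ≤ X.sum

/-- `CheckSignificant-Var (X, δ)`. -/
def CheckSignificantVar (D₁ : ℝ) (X : List ℝ) (δ : ℝ) : Prop :=
  Real.log (1 / δ) ≤ X.length ∧ qThreshold D₁ (empVar X) δ ≤ X.sum

/-- `X 0, X 1, …` are i.i.d. real random variables with values in `[-2, 2]` and mean zero. -/
structure IsCenteredIID {Ω : Type} [MeasurableSpace Ω] (μ : Measure Ω) (X : ℕ → Ω → ℝ) : Prop where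
  measurable : ∀ i, Measurable (X i)
  indep : iIndepFun X μ
  identDistrib : ∀ i, IdentDistrib (X i) (X 0) μ μ
  bounded : ∀ᵐ ω ∂μ, X 0 ω ∈ Icc (-2 : ℝ) 2
  mean : ∫ ω, X 0 ω ∂μ = 0

/-- The array `X₁, …, Xₙ` of the first `n` members of a sequence. -/
def firstN (X : ℕ → ℝ) (n : ℕ) : List ℝ := (List.range n).map X

/-- `D₀` is a constant for which the uniform concentration inequality
`|X₁ + ⋯ + Xₙ| ≤ p(n, δ)` for all `n > 0` holds with probability at least `1 - δ`. -/
def IsUniformConst (D₀ : ℝ) : Prop :=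
  ∀ (Ω : Type) [MeasurableSpace Ω] (μ : Measure Ω) [IsProbabilityMeasure μ] (X : ℕ → Ω → ℝ),
    IsCenteredIID μ X → ∀ δ : ℝ, 0 < δ → δ < 1 →
      1 - δ ≤ μ.real {ω | ∀ n : ℕ, 0 < n →
        |(firstN (fun i => X i ω) n).sum| ≤ pThreshold D₀ n δ}

/-- `D₁` is a constant for which the uniform empirical concentration inequality
`|X₁ + ⋯ + Xₙ| ≤ q(Vₙ, δ)` for all `n ≥ ln (1 / δ)`, where `Vₙ` is the empirical variance, holds
with probability at least `1 - δ`. -/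
def IsUniformEmpiricalConst (D₁ : ℝ) : Prop :=
  ∀ (Ω : Type) [MeasurableSpace Ω] (μ : Measure Ω) [IsProbabilityMeasure μ] (X : ℕ → Ω → ℝ),
    IsCenteredIID μ X → ∀ δ : ℝ, 0 < δ → δ < 1 →
      1 - δ ≤ μ.real {ω | ∀ n : ℕ, 0 < n → Real.log (1 / δ) ≤ n →
        |(firstN (fun i => X i ω) n).sum| ≤
          qThreshold D₁ (empVar (firstN (fun i => X i ω) n)) δ}

/-- The entry of the array `A` for a response: `1` for a label, `0` for an abstention. -/
def nonAbstain : Response → ℝ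
  | none => 0
  | some _ => 1

/-- The `±1` value of a 0/1 label. -/
def signOf (b : Bool) : ℝ := if b then 1 else -1

/-- The array `A⁽ᵘ⁾ᵢ - A⁽ᵐ⁾ᵢ`, `i = 1, …, n`, for two sequences of responses. -/
def abstentionDiffs (y z : ℕ → Response) (n : ℕ) : List ℝ :=
  (List.range n).map fun i => nonAbstain (y i) - nonAbstain (z i)

/-- The array `B` of the `±1` labels among the first `n` responses, abstentions being skipped. -/
def labelArray (y : ℕ → Response) (n : ℕ) : List ℝ :=
  (List.range n).filterMap fun i => (y i).map signOf

/-- The current state between two rounds: the number of queries made so far and the current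
interval `[left, right]`. -/
structure State where
  queries : ℕ
  left : ℝ
  right : ℝ

open Classical in
/-- The tests made after `n` triples of queries at the quartiles `U`, `M`, `V` of `[l, r]`, with
responses `Y 0 x, …, Y (n - 1) x` at each `x` of the three points. The value is the next interval
if some test succeeds, the first successful one deciding, and `none` if all fail.
If `useLabels` is `false`, then the two tests of the 0/1 labels are left out. -/
def tests (D₀ D₁ δ' : ℝ) (useLabels : Bool) (l r : ℝ) (Y : ℕ → ℝ → Response) (n : ℕ) :
    Option (ℝ × ℝ) :=
  let U := (3 * l + r) / 4
  let M := (l + r) / 2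
  let V := (l + 3 * r) / 4
  if CheckSignificantVar D₁ (abstentionDiffs (fun i => Y i U) (fun i => Y i M) n) δ' then
    some (U, r)
  else if CheckSignificantVar D₁ (abstentionDiffs (fun i => Y i V) (fun i => Y i M) n) δ' then
    some (l, V)
  else if useLabels = true ∧
      CheckSignificant D₀ ((labelArray (fun i => Y i U) n).map (fun b => -b)) δ' then
    some (U, r)
  else if useLabels = true ∧ CheckSignificant D₀ (labelArray (fun i => Y i V) n) δ' then
    some (l, V)
  else none

open Classical in
/-- One round: query at the three quartiles until, after some number `n ≥ 1` of triples of queries,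
a test succeeds. The value is `none` if this never happens. -/
def oneRound (D₀ D₁ δ' : ℝ) (useLabels : Bool) (Y : ℕ → ℝ → Response) (s : State) : Option State :=
  if h : ∃ n : ℕ, 1 ≤ n ∧ (tests D₀ D₁ δ' useLabels s.left s.right Y n).isSome = true then
    (tests D₀ D₁ δ' useLabels s.left s.right Y (Nat.find h)).map fun I =>
      { queries := s.queries + 3 * Nat.find h, left := I.1, right := I.2 }
  else none

/-- The state after `k` rounds, started from `[0, 1]`; `none` if one of these rounds never ends.
`Y (k, i, x)` is the response to the `(i + 1)`-st query at `x` in round `k`. -/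
def run (D₀ D₁ δ' : ℝ) (useLabels : Bool) (Y : ℕ × ℕ × ℝ → Response) : ℕ → Option State
  | 0 => some { queries := 0, left := 0, right := 1 }
  | k + 1 => (run D₀ D₁ δ' useLabels Y k).bind
      (oneRound D₀ D₁ δ' useLabels (fun i x => Y (k, i, x)))

/-- The number `log_{4/3} (1 / (2 ε))`. -/
def numRounds (ε : ℝ) : ℝ := Real.logb (4 / 3) (1 / (2 * ε))

/-- The algorithm with input `ε`, `δ` on the responses `Y`: the number of queries that it makes and
its output `θ̂`, or `none` if it does not halt. With `useLabels = true` it is the full algorithm,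
with `useLabels = false` the variant that disregards the 0/1 labels. -/
def algorithm (D₀ D₁ ε δ : ℝ) (useLabels : Bool) (Y : ℕ × ℕ × ℝ → Response) : Option (ℕ × ℝ) :=
  (run D₀ D₁ (δ / (4 * numRounds ε)) useLabels Y ⌊numRounds ε⌋₊).map fun s =>
    (s.queries, (s.left + s.right) / 2)

/-- The law of the responses: independent, and distributed as `P x` for each query at `x`. Each
query of the algorithm reads an entry of its own, hence its response has distribution `P x` given
the point `x` of the query and all earlier responses. -/
def responseLaw (P : Labeler) : Measure (ℕ × ℕ × ℝ → Response) :=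
  Measure.infinitePi fun q => (P q.2.2).toMeasure

end

end AbstainingLabeler

/-!
Each round of the algorithm compares the abstention rates at the quartiles `U`, `M`, `V` of the
current interval. The flatness condition makes the rate at which the labeler answers at the quartile
farther from `θ` exceed the rate at `M` by the factor `1 / (1 - c)`, because the ratio of the two
distances to `θ` is at most `2 / 3`; and on the wrong side of `θ` the difference has the opposite
sign. A test that errs therefore contradicts the concentration inequality for i.i.d. variables of
negative (or, for the labels, nonpositive) mean, whatever the flip rate (`measure_roundBad_le`,
`exists_oneRound_eq`).

For the number of queries, let `F` be the answer rate at the farther quartile and `L = ln (1 / δ')`.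
The variance of a difference is of order `F`, like its mean, so by an exponential Markov bound for
the number of answers the empirical variance after `n` triples is `O(n F + L)`. As the threshold is
sublinear in its variance argument (`exists_devBound_le_linear`), the test succeeds once
`n F ≥ A L` for a constant `A`. In all rounds `F ≥ f (ε / 2)`, which gives the bound
`O(L / f (ε / 2))` per round, and there are `O(ln (1 / ε))` rounds; the division of `δ` among them
contributes the `ln ln (1 / ε)` term (`algorithm_guarantee`).

The interval of a round depends on earlier responses, so the failure events of a round are bounded
conditionally on the current state, which is independent of the responses in that round
(`measure_run_and_le`). The test of the labels looks at the responses that are not abstentions. Its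
analysis represents i.i.d. responses as assembled from independent answer indicators and
independent labels (`map_assemble`), so that the array of labels is an initial segment of an i.i.d.
sequence.

The constants `D₀` and `D₁` exist by Ville's inequality for `exp (r * S_n - n * r ^ 2 * v)`, applied
with one exponent `r` for each dyadic scale of `n * v` (`measure_exists_devBound_lt_sum_le`). For
`D₁` the same inequality for `σ ^ 2 - X_i ^ 2` shows that the empirical variance dominates the true
one up to a term of order `L + 1` (`exists_variance_le_empVar`).
-/

namespace AbstainingLabeler

noncomputable section

/-! ### The deviation bound -/

/-- The common shape of the two thresholds: with `L = ln (1 / δ)`, one has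
`p(n, δ) = D₀ * devBound (4 n) L` and `q(V, δ) = D₁ * devBound (V + L + 1) L`. -/
def devBound (x L : ℝ) : ℝ := 1 + L + √(x * (lnlnPlus x + L))

theorem pThreshold_eq (D : ℝ) (n : ℕ) (δ : ℝ) :
    pThreshold D n δ = D * devBound (4 * n) (Real.log (1 / δ)) := rfl

theorem qThreshold_eq (D v δ : ℝ) :
    qThreshold D v δ = D * devBound (v + Real.log (1 / δ) + 1) (Real.log (1 / δ)) := rfl

theorem exp_one_le_log_max (x : ℝ) :
    Real.exp 1 ≤ Real.log (max x (Real.exp (Real.exp 1))) := by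
  rw [Real.le_log_iff_exp_le (lt_max_of_lt_right (Real.exp_pos _))]
  exact le_max_right _ _

theorem one_le_log_max (x : ℝ) : 1 ≤ Real.log (max x (Real.exp (Real.exp 1))) :=
  (Real.one_le_exp zero_le_one).trans (exp_one_le_log_max x)

theorem one_le_lnlnPlus (x : ℝ) : 1 ≤ lnlnPlus x := by
  have h := exp_one_le_log_max x
  rwa [lnlnPlus, Real.le_log_iff_exp_le ((Real.exp_pos 1).trans_le h)]

theorem lnlnPlus_mono {x y : ℝ} (h : x ≤ y) : lnlnPlus x ≤ lnlnPlus y := by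
  unfold lnlnPlus
  have h1 := one_le_log_max x
  refine Real.log_le_log (by linarith) (Real.log_le_log ?_ (max_le_max_right _ h))
  exact lt_max_of_lt_right (Real.exp_pos _)

theorem lnlnPlus_le_self {x : ℝ} (hx : 1 ≤ x) : lnlnPlus x ≤ x := by
  rcases le_total x (Real.exp (Real.exp 1)) with h | h
  · rw [lnlnPlus, max_eq_right h, Real.log_exp, Real.log_exp]
    exact hx
  · have h1 := one_le_log_max x
    rw [max_eq_left h] at h1
    rw [lnlnPlus, max_eq_left h]
    have := Real.log_le_sub_one_of_pos (x := Real.log x) (by linarith)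
    have := Real.log_le_sub_one_of_pos (x := x) (by linarith)
    linarith

theorem lnlnPlus_mul_le {C x : ℝ} (hC : 1 ≤ C) :
    lnlnPlus (C * x) ≤ C * lnlnPlus x := by
  have hy := one_le_log_max x
  have hlogC := Real.log_le_sub_one_of_pos (x := C) (by linarith)
  have hll := one_le_lnlnPlus x
  have hE : 0 < Real.exp (Real.exp 1) := Real.exp_pos _
  have hm : 0 < max x (Real.exp (Real.exp 1)) := lt_max_of_lt_right hE
  have h1 : max (C * x) (Real.exp (Real.exp 1)) ≤ C * max x (Real.exp (Real.exp 1)) := by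
    refine max_le (by gcongr; exact le_max_left _ _) ?_
    calc Real.exp (Real.exp 1) ≤ max x (Real.exp (Real.exp 1)) := le_max_right _ _
      _ ≤ _ := le_mul_of_one_le_left hm.le hC
  have h2 : Real.log (max (C * x) (Real.exp (Real.exp 1))) ≤
      C * Real.log (max x (Real.exp (Real.exp 1))) := by
    calc _ ≤ Real.log (C * max x (Real.exp (Real.exp 1))) :=
          Real.log_le_log (lt_max_of_lt_right hE) h1
      _ = Real.log C + Real.log (max x (Real.exp (Real.exp 1))) :=
          Real.log_mul (by linarith) hm.ne'
      _ ≤ _ := by nlinarith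
  calc lnlnPlus (C * x) ≤ Real.log (C * Real.log (max x (Real.exp (Real.exp 1)))) :=
        Real.log_le_log (by linarith [one_le_log_max (C * x)]) h2
    _ = Real.log C + lnlnPlus x := Real.log_mul (by linarith) (by linarith)
    _ ≤ _ := by nlinarith

theorem exists_lnlnPlus_le_linear {η : ℝ} (hη : 0 < η) :
    ∃ K : ℝ, 0 ≤ K ∧ ∀ x, 0 ≤ x → lnlnPlus x ≤ η * x + K := by
  refine ⟨max 0 (η * Real.exp (Real.exp 1) - Real.log η), le_max_left _ _, fun x hx => ?_⟩
  have hE : 0 < Real.exp (Real.exp 1) := Real.exp_pos _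
  have hm : 0 < max x (Real.exp (Real.exp 1)) := lt_max_of_lt_right hE
  have h1 := one_le_log_max x
  have h2 := Real.log_le_sub_one_of_pos (x := Real.log (max x (Real.exp (Real.exp 1))))
    (by linarith)
  have h3 := Real.log_le_sub_one_of_pos (x := η * max x (Real.exp (Real.exp 1))) (by positivity)
  rw [Real.log_mul hη.ne' hm.ne'] at h3
  have h4 : max x (Real.exp (Real.exp 1)) ≤ x + Real.exp (Real.exp 1) :=
    max_le (by linarith) (by linarith)
  have h5 := mul_le_mul_of_nonneg_left h4 hη.le
  have h6 := le_max_right 0 (η * Real.exp (Real.exp 1) - Real.log η)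
  unfold lnlnPlus
  linarith

theorem one_le_devBound {x L : ℝ} (hL : 0 ≤ L) : 1 ≤ devBound x L := by
  have := Real.sqrt_nonneg (x * (lnlnPlus x + L))
  unfold devBound
  linarith

theorem devBound_mono {x y L M : ℝ} (hx : 0 ≤ x) (hxy : x ≤ y) (hL : 0 ≤ L) (hLM : L ≤ M) :
    devBound x L ≤ devBound y M := by
  unfold devBound
  have h1 := lnlnPlus_mono hxy
  have h2 := one_le_lnlnPlus x
  have h3 := hx.trans hxy
  gcongr

theorem devBound_mul_add_le {C a x L : ℝ} (hC : 1 ≤ C) (haC : a ≤ C) (hx : 0 ≤ x)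
    (hL : 0 ≤ L) : devBound (C * x) (L + a) ≤ 2 * C * devBound x L := by
  have h1 := lnlnPlus_mul_le (x := x) hC
  have h2 := one_le_lnlnPlus x
  have h3 : √(C * x * (lnlnPlus (C * x) + (L + a))) ≤ 2 * C * √(x * (lnlnPlus x + L)) := by
    rw [show 2 * C * √(x * (lnlnPlus x + L)) = √((2 * C) ^ 2 * (x * (lnlnPlus x + L))) by
      rw [Real.sqrt_mul (sq_nonneg (2 * C)), Real.sqrt_sq (by linarith)]]
    refine Real.sqrt_le_sqrt ?_
    have h4 : lnlnPlus (C * x) + (L + a) ≤ 4 * C * (lnlnPlus x + L) := by nlinarith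
    calc C * x * (lnlnPlus (C * x) + (L + a)) ≤ C * x * (4 * C * (lnlnPlus x + L)) := by gcongr
      _ = _ := by ring
  unfold devBound
  nlinarith

theorem sqrt_mul_le_add_div {η x y : ℝ} (hη : 0 < η) (hx : 0 ≤ x) (hy : 0 ≤ y) :
    √(x * y) ≤ (η * x + y / η) / 2 := by
  rw [Real.sqrt_le_left (by positivity)]
  have : x * y = (η * x) * (y / η) := by field_simp
  rw [this]
  nlinarith [sq_nonneg (η * x - y / η)]

/-- The deviation bound is sublinear in its first argument. -/
theorem exists_devBound_le_linear {η : ℝ} (hη : 0 < η) :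
    ∃ K : ℝ, 0 ≤ K ∧ ∀ x L, 0 ≤ x → 0 ≤ L → devBound x L ≤ η * x + K * (1 + L) := by
  obtain ⟨K, hK0, hK⟩ := exists_lnlnPlus_le_linear (η := η ^ 2) (by positivity)
  refine ⟨1 + (K + 1) / (2 * η), by positivity, fun x L hx hL => ?_⟩
  have h1 := one_le_lnlnPlus x
  have h2 := sqrt_mul_le_add_div hη hx (y := lnlnPlus x + L) (by linarith)
  have h3 : (lnlnPlus x + L) / η ≤ η * x + (K + 1) * (1 + L) / η := by
    rw [div_le_iff₀ hη, add_mul, div_mul_cancel₀ _ hη.ne']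
    have := hK x hx
    nlinarith
  have h4 : (1 + (K + 1) / (2 * η)) * (1 + L) = 1 + L + (K + 1) * (1 + L) / η / 2 := by
    field_simp
  unfold devBound
  linarith

/-! ### Ville's inequality for products of independent variables -/

section Ville

open scoped ENNReal

variable {Ω : Type*}

/-- The product `W 0 * ⋯ * W (n - 1)`, stopped when it reaches the level `t`. -/
def stoppedProd (t : ℝ≥0∞) (W : ℕ → Ω → ℝ≥0∞) : ℕ → Ω → ℝ≥0∞
  | 0 => fun _ => 1
  | n + 1 => fun ω => stoppedProd t W n ω * if t ≤ stoppedProd t W n ω then 1 else W n ω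

theorem stoppedProd_measurable (t : ℝ≥0∞) (W : ℕ → Ω → ℝ≥0∞) (n : ℕ) :
    Measurable[⨆ i ∈ Iio n, MeasurableSpace.comap (W i) inferInstance] (stoppedProd t W n) := by
  induction n with
  | zero => exact measurable_const
  | succ n ih =>
    have h1 : Measurable[⨆ i ∈ Iio (n + 1), MeasurableSpace.comap (W i) inferInstance]
        (stoppedProd t W n) :=
      ih.mono (biSup_mono fun i hi => (mem_Iio.1 hi).trans n.lt_succ_self) le_rfl
    have h2 : Measurable[⨆ i ∈ Iio (n + 1), MeasurableSpace.comap (W i) inferInstance] (W n) :=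
      (comap_measurable (W n)).mono
        (le_biSup (fun i => MeasurableSpace.comap (W i) inferInstance) (mem_Iio.2 n.lt_succ_self))
        le_rfl
    exact h1.mul (Measurable.ite (measurableSet_le measurable_const h1) measurable_const h2)

variable [MeasurableSpace Ω] {μ : Measure Ω}

theorem lintegral_stoppedProd_le_one [IsProbabilityMeasure μ] {W : ℕ → Ω → ℝ≥0∞}
    (hW : ∀ i, Measurable (W i)) (hind : iIndepFun W μ) (h1 : ∀ i, ∫⁻ ω, W i ω ∂μ ≤ 1)
    (t : ℝ≥0∞) (n : ℕ) : ∫⁻ ω, stoppedProd t W n ω ∂μ ≤ 1 := by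
  induction n with
  | zero => simp [stoppedProd]
  | succ n ih =>
    have hle : ∀ i, MeasurableSpace.comap (W i) inferInstance ≤ ‹MeasurableSpace Ω› :=
      fun i => (hW i).comap_le
    have hle' : (⨆ i ∈ Iio n, MeasurableSpace.comap (W i) inferInstance) ≤ ‹MeasurableSpace Ω› :=
      iSup₂_le fun i _ => hle i
    have hT := stoppedProd_measurable t W n
    have hA : MeasurableSet[⨆ i ∈ Iio n, MeasurableSpace.comap (W i) inferInstance]
        {ω | t ≤ stoppedProd t W n ω} := measurableSet_le measurable_const hT
    have hsplit : ∀ ω, stoppedProd t W (n + 1) ω =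
        {ω | t ≤ stoppedProd t W n ω}.indicator (stoppedProd t W n) ω +
        {ω | t ≤ stoppedProd t W n ω}ᶜ.indicator (stoppedProd t W n) ω * W n ω := by
      intro ω
      by_cases h : t ≤ stoppedProd t W n ω <;> simp [stoppedProd, h]
    have hindep : Indep (⨆ i ∈ Iio n, MeasurableSpace.comap (W i) inferInstance)
        (MeasurableSpace.comap (W n) inferInstance) μ := by
      have := indep_iSup_of_disjoint hle hind.iIndep (S := Iio n) (T := {n}) (by simp)
      simpa using this
    have hAm := hle' _ hA
    have hTm : Measurable (stoppedProd t W n) := hT.mono hle' le_rfl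
    calc ∫⁻ ω, stoppedProd t W (n + 1) ω ∂μ
        = ∫⁻ ω, {ω | t ≤ stoppedProd t W n ω}.indicator (stoppedProd t W n) ω ∂μ +
          ∫⁻ ω, {ω | t ≤ stoppedProd t W n ω}ᶜ.indicator (stoppedProd t W n) ω * W n ω ∂μ := by
          simp_rw [hsplit]
          exact lintegral_add_left (hTm.indicator hAm) _
      _ = ∫⁻ ω, {ω | t ≤ stoppedProd t W n ω}.indicator (stoppedProd t W n) ω ∂μ +
          (∫⁻ ω, {ω | t ≤ stoppedProd t W n ω}ᶜ.indicator (stoppedProd t W n) ω ∂μ) *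
            ∫⁻ ω, W n ω ∂μ := by
          rw [lintegral_mul_eq_lintegral_mul_lintegral_of_independent_measurableSpace hle' (hle n)
            hindep (hT.indicator hA.compl) (comap_measurable (W n))]
      _ ≤ ∫⁻ ω, {ω | t ≤ stoppedProd t W n ω}.indicator (stoppedProd t W n) ω ∂μ +
          ∫⁻ ω, {ω | t ≤ stoppedProd t W n ω}ᶜ.indicator (stoppedProd t W n) ω ∂μ := by
          gcongr
          exact mul_le_of_le_one_right zero_le (h1 n)
      _ = ∫⁻ ω, stoppedProd t W n ω ∂μ := by
          rw [lintegral_indicator hAm, lintegral_indicator hAm.compl, lintegral_add_compl _ hAm]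
      _ ≤ 1 := ih

/-- Ville's inequality: a product of independent nonnegative variables with means at most `1`
ever reaches the level `t` with probability at most `1 / t`. -/
theorem measure_exists_le_prod_le [IsProbabilityMeasure μ] {W : ℕ → Ω → ℝ≥0∞}
    (hW : ∀ i, Measurable (W i)) (hind : iIndepFun W μ) (h1 : ∀ i, ∫⁻ ω, W i ω ∂μ ≤ 1)
    {t : ℝ≥0∞} (ht : t ≠ 0) (ht' : t ≠ ∞) :
    μ {ω | ∃ n, t ≤ ∏ i ∈ Finset.range n, W i ω} ≤ t⁻¹ := by
  have hmono : Monotone fun n => {ω | t ≤ stoppedProd t W n ω} :=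
    monotone_nat_of_le_succ fun n ω (hω : t ≤ stoppedProd t W n ω) => by
      simp [stoppedProd, hω]
  have hsub : {ω | ∃ n, t ≤ ∏ i ∈ Finset.range n, W i ω} ⊆
      ⋃ n, {ω | t ≤ stoppedProd t W n ω} := by
    rintro ω ⟨n, hn⟩
    by_contra hcon
    simp only [mem_iUnion, mem_ofPred_eq, not_exists] at hcon
    have heq : ∀ m, stoppedProd t W m ω = ∏ i ∈ Finset.range m, W i ω := by
      intro m
      induction m with
      | zero => simp [stoppedProd]
      | succ m ih => rw [Finset.prod_range_succ, ← ih]; simp [stoppedProd, hcon m]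
    exact hcon n (heq n ▸ hn)
  refine (measure_mono hsub).trans ?_
  rw [hmono.measure_iUnion]
  refine iSup_le fun n => ?_
  have hTm : Measurable (stoppedProd t W n) :=
    (stoppedProd_measurable t W n).mono (iSup₂_le fun i _ => (hW i).comap_le) le_rfl
  calc μ {ω | t ≤ stoppedProd t W n ω} ≤ (∫⁻ ω, stoppedProd t W n ω ∂μ) / t :=
        meas_ge_le_lintegral_div hTm.aemeasurable ht ht'
    _ ≤ 1 / t := by gcongr; exact lintegral_stoppedProd_le_one hW hind h1 t n
    _ = t⁻¹ := one_div t

/-- Ville's inequality for the exponential of a random walk. -/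
theorem measure_exists_le_sum_le [IsProbabilityMeasure μ] {Z : ℕ → Ω → ℝ}
    (hZ : ∀ i, Measurable (Z i)) (hind : iIndepFun Z μ)
    (hid : ∀ i, IdentDistrib (Z i) (Z 0) μ μ) {r a : ℝ}
    (h1 : ∫⁻ ω, ENNReal.ofReal (Real.exp (r * Z 0 ω - a)) ∂μ ≤ 1) (l : ℝ) :
    μ {ω | ∃ n : ℕ, l ≤ r * (∑ i ∈ Finset.range n, Z i ω) - n * a} ≤
      ENNReal.ofReal (Real.exp (-l)) := by
  have hg : Measurable fun z : ℝ => ENNReal.ofReal (Real.exp (r * z - a)) := by fun_prop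
  have key := measure_exists_le_prod_le (μ := μ)
    (W := fun i ω => ENNReal.ofReal (Real.exp (r * Z i ω - a)))
    (fun i => hg.comp (hZ i)) (hind.comp (fun _ => _) fun _ => hg)
    (fun i => by
      refine le_of_eq_of_le ?_ h1
      exact ((hid i).comp hg).lintegral_eq)
    (t := ENNReal.ofReal (Real.exp l)) (by simp [Real.exp_pos]) ENNReal.ofReal_ne_top
  rw [← ENNReal.ofReal_inv_of_pos (Real.exp_pos _), ← Real.exp_neg] at key
  refine (measure_mono ?_).trans key
  rintro ω ⟨n, hn⟩
  refine ⟨n, ?_⟩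
  rw [← ENNReal.ofReal_prod_of_nonneg fun i _ => (Real.exp_pos _).le, ← Real.exp_sum]
  refine ENNReal.ofReal_le_ofReal (Real.exp_le_exp.2 (hn.trans_eq ?_))
  rw [Finset.sum_sub_distrib, ← Finset.mul_sum]
  simp

end Ville

/-! ### Time-uniform concentration of random walks -/

section Concentration

variable {Ω : Type*} [MeasurableSpace Ω] {μ : Measure Ω}

/-- `exp x ≤ 1 + x + x ^ 2` for `|x| ≤ 1` gives a sub-gamma bound of the moment generating
function in terms of a bound `v` on the second moment. -/
theorem lintegral_exp_le_one [IsProbabilityMeasure μ] {Z : Ω → ℝ} (hZ : Measurable Z)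
    (hb : ∀ᵐ ω ∂μ, |Z ω| ≤ 4) (hmean : ∫ ω, Z ω ∂μ ≤ 0) {v : ℝ}
    (hv : ∫ ω, Z ω ^ 2 ∂μ ≤ v) {r : ℝ} (hr0 : 0 ≤ r) (hr : r ≤ 1 / 4) :
    ∫⁻ ω, ENNReal.ofReal (Real.exp (r * Z ω - r ^ 2 * v)) ∂μ ≤ 1 := by
  have hZi : Integrable Z μ :=
    Integrable.of_bound hZ.aestronglyMeasurable 4 (by simpa only [Real.norm_eq_abs] using hb)
  have hZ2i : Integrable (fun ω => Z ω ^ 2) μ := by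
    refine Integrable.of_bound (hZ.pow_const 2).aestronglyMeasurable 16 ?_
    filter_upwards [hb] with ω hω
    rw [Real.norm_eq_abs, abs_pow]
    nlinarith [abs_nonneg (Z ω)]
  have hpt : ∀ᵐ ω ∂μ, Real.exp (r * Z ω - r ^ 2 * v) ≤
      Real.exp (-(r ^ 2 * v)) * (1 + r * Z ω + r ^ 2 * Z ω ^ 2) := by
    filter_upwards [hb] with ω hω
    have h1 : |r * Z ω| ≤ 1 := by
      rw [abs_mul, abs_of_nonneg hr0]
      nlinarith [abs_nonneg (Z ω)]
    have h2 := (abs_le.1 (Real.abs_exp_sub_one_sub_id_le h1)).2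
    rw [sub_eq_neg_add, Real.exp_add]
    gcongr
    nlinarith
  have hint : Integrable
      (fun ω => Real.exp (-(r ^ 2 * v)) * (1 + r * Z ω + r ^ 2 * Z ω ^ 2)) μ :=
    (((integrable_const 1).add (hZi.const_mul r)).add (hZ2i.const_mul (r ^ 2))).const_mul _
  calc ∫⁻ ω, ENNReal.ofReal (Real.exp (r * Z ω - r ^ 2 * v)) ∂μ
      ≤ ∫⁻ ω, ENNReal.ofReal
          (Real.exp (-(r ^ 2 * v)) * (1 + r * Z ω + r ^ 2 * Z ω ^ 2)) ∂μ := by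
        refine lintegral_mono_ae ?_
        filter_upwards [hpt] with ω hω
        exact ENNReal.ofReal_le_ofReal hω
    _ = ENNReal.ofReal (∫ ω, Real.exp (-(r ^ 2 * v)) * (1 + r * Z ω + r ^ 2 * Z ω ^ 2) ∂μ) := by
        refine (ofReal_integral_eq_lintegral_ofReal hint ?_).symm
        filter_upwards [hpt] with ω hω
        exact (Real.exp_pos _).le.trans hω
    _ ≤ ENNReal.ofReal 1 := by
        refine ENNReal.ofReal_le_ofReal ?_
        have hsum : ∫ ω, (1 + r * Z ω + r ^ 2 * Z ω ^ 2) ∂μ =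
            1 + r * ∫ ω, Z ω ∂μ + r ^ 2 * ∫ ω, Z ω ^ 2 ∂μ := by
          have hlin : Integrable (fun ω => 1 + r * Z ω) μ :=
            (integrable_const 1).add (hZi.const_mul r)
          rw [integral_add hlin (hZ2i.const_mul (r ^ 2)),
            integral_add (integrable_const 1) (hZi.const_mul r), integral_const_mul,
            integral_const_mul]
          simp
        rw [integral_const_mul, hsum]
        have h3 : 1 + r * ∫ ω, Z ω ∂μ + r ^ 2 * ∫ ω, Z ω ^ 2 ∂μ ≤ Real.exp (r ^ 2 * v) := by
          have := Real.add_one_le_exp (r ^ 2 * v)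
          have : r * ∫ ω, Z ω ∂μ ≤ 0 := mul_nonpos_of_nonneg_of_nonpos hr0 hmean
          have : r ^ 2 * ∫ ω, Z ω ^ 2 ∂μ ≤ r ^ 2 * v := by gcongr
          linarith
        calc _ ≤ Real.exp (-(r ^ 2 * v)) * Real.exp (r ^ 2 * v) := by gcongr
          _ = 1 := by rw [← Real.exp_add]; simp
    _ = 1 := ENNReal.ofReal_one

/-- The logarithm of the inverse of the share `δ / ((k + 1) (k + 2))` of the failure probability
that is granted to the scale `2 ^ k`. -/
def scaleLog (L : ℝ) (k : ℕ) : ℝ := L + Real.log ((k + 1) * (k + 2))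

/-- The exponent `min {1 / 4, √(ℓ / 2 ^ k)}` that is nearly optimal at the scale `2 ^ k`. -/
def scaleExponent (L : ℝ) (k : ℕ) : ℝ := min (1 / 4) (√(scaleLog L k / 2 ^ k))

theorem scaleLog_pos {L : ℝ} (hL : 0 ≤ L) (k : ℕ) : 0 < scaleLog L k := by
  have : 0 < Real.log ((k + 1) * (k + 2) : ℝ) := by
    refine Real.log_pos ?_
    have : (0 : ℝ) ≤ k := k.cast_nonneg
    nlinarith
  unfold scaleLog
  linarith

theorem scaleExponent_pos {L : ℝ} (hL : 0 ≤ L) (k : ℕ) : 0 < scaleExponent L k := by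
  have := scaleLog_pos hL k
  exact lt_min (by norm_num) (Real.sqrt_pos.2 (by positivity))

theorem sum_inv_mul_succ_le_one (n : ℕ) :
    ∑ k ∈ Finset.range n, (1 : ℝ) / ((k + 1) * (k + 2)) ≤ 1 := by
  have h : ∑ k ∈ Finset.range n, (1 : ℝ) / ((k + 1) * (k + 2)) = 1 - 1 / (n + 1) := by
    induction n with
    | zero => simp
    | succ n ih =>
      rw [Finset.sum_range_succ, ih]
      push_cast
      field_simp
      ring
  rw [h]
  have : (0 : ℝ) ≤ 1 / (n + 1) := by positivity
  linarith

/-- At the dyadic scale of `x` the union bound over scales costs only a `ln ln x` term. -/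
theorem scaleLog_le {L x : ℝ} {m : ℕ} (hm : 2 ^ m ≤ x) :
    scaleLog L (m + 1) ≤ L + 4 * lnlnPlus x := by
  set y := Real.log (max x (Real.exp (Real.exp 1))) with hy
  have hye : 2.7 ≤ y := by
    have := exp_one_le_log_max x
    have := Real.exp_one_gt_d9
    linarith
  have hm' : (m : ℝ) * Real.log 2 ≤ y := by
    rw [← Real.log_pow]
    exact Real.log_le_log (by positivity) (hm.trans (le_max_left _ _))
  have hlog2 := Real.log_two_gt_d9
  have hm0 : (0 : ℝ) ≤ m := m.cast_nonneg
  have hmy : (m : ℝ) + 3 ≤ y ^ 2 := by nlinarith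
  have h1 : (((m + 1 : ℕ) : ℝ) + 1) * (((m + 1 : ℕ) : ℝ) + 2) ≤ y ^ 4 := by
    push_cast
    calc ((m : ℝ) + 1 + 1) * (m + 1 + 2) ≤ y ^ 2 * y ^ 2 := by
          apply mul_le_mul <;> nlinarith
      _ = y ^ 4 := by ring
  have h2 : Real.log ((((m + 1 : ℕ) : ℝ) + 1) * (((m + 1 : ℕ) : ℝ) + 2)) ≤ 4 * lnlnPlus x := by
    calc _ ≤ Real.log (y ^ 4) := Real.log_le_log (by positivity) h1
      _ = 4 * lnlnPlus x := by rw [Real.log_pow]; rfl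
  unfold scaleLog
  linarith

/-- Bounds that hold at every scale combine to the deviation bound: for the walk `S` at time `n`
one uses the scale of `n * v + 1`. -/
theorem le_devBound_of_scales {L v S : ℝ} {n : ℕ} (hL : 0 ≤ L) (hv : 0 ≤ v)
    (h : ∀ k, scaleExponent L k * S - n * (scaleExponent L k ^ 2 * v) < scaleLog L k) :
    S ≤ 22 * devBound (n * v + 1) L := by
  set x := n * v + 1 with hx
  have hnv : 0 ≤ n * v := by positivity
  have hx1 : 1 ≤ x := by linarith
  obtain ⟨m, hm1, hm2⟩ := exists_nat_pow_near hx1 one_lt_two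
  have hk := h (m + 1)
  have hl := scaleLog_le (L := L) hm1
  have hlpos := scaleLog_pos hL (m + 1)
  have hepos := scaleExponent_pos hL (m + 1)
  set l := scaleLog L (m + 1)
  set r := scaleExponent L (m + 1) with hr
  have hp : (0 : ℝ) < 2 ^ (m + 1) := by positivity
  have hS : S ≤ r * 2 ^ (m + 1) + l / r := by
    have h1 : r * S ≤ r * (r * 2 ^ (m + 1) + l / r) := by
      have h2 : r * (r * 2 ^ (m + 1) + l / r) = r ^ 2 * 2 ^ (m + 1) + l := by
        field_simp
      have h3 : r ^ 2 * (n * v) ≤ r ^ 2 * 2 ^ (m + 1) := by gcongr; linarith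
      nlinarith
    exact le_of_mul_le_mul_left h1 hepos
  have hsq : √(l / 2 ^ (m + 1)) * 2 ^ (m + 1) = √(l * 2 ^ (m + 1)) := by
    rw [show l * 2 ^ (m + 1) = l / 2 ^ (m + 1) * (2 ^ (m + 1)) ^ 2 by field_simp,
      Real.sqrt_mul (by positivity), Real.sqrt_sq hp.le]
  have h1 : r * 2 ^ (m + 1) ≤ √(l * 2 ^ (m + 1)) := by
    rw [← hsq]
    gcongr
    exact min_le_right _ _
  have h2 : l / r ≤ √(l * 2 ^ (m + 1)) + 4 * l := by
    rcases min_choice (1 / 4) (√(l / 2 ^ (m + 1))) with h' | h'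
    · have : r = 1 / 4 := h'
      rw [this]
      have := Real.sqrt_nonneg (l * 2 ^ (m + 1))
      linarith
    · have hrr : r = √(l / 2 ^ (m + 1)) := h'
      have : l / r = √(l * 2 ^ (m + 1)) := by
        rw [div_eq_iff hepos.ne', hrr, ← Real.sqrt_mul (by positivity),
          show l * 2 ^ (m + 1) * (l / 2 ^ (m + 1)) = l ^ 2 by field_simp, Real.sqrt_sq hlpos.le]
      linarith
  have hll := one_le_lnlnPlus x
  have h3 : √(l * 2 ^ (m + 1)) ≤ 3 * √(x * (lnlnPlus x + L)) := by
    rw [show 3 * √(x * (lnlnPlus x + L)) = √(3 ^ 2 * (x * (lnlnPlus x + L))) by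
      rw [Real.sqrt_mul (sq_nonneg (3 : ℝ)), Real.sqrt_sq (by norm_num)]]
    refine Real.sqrt_le_sqrt ?_
    have h4 : (2 : ℝ) ^ (m + 1) ≤ 2 * x := by rw [pow_succ]; linarith
    calc l * 2 ^ (m + 1) ≤ (4 * (lnlnPlus x + L)) * (2 * x) := by
          gcongr
          linarith
      _ ≤ 3 ^ 2 * (x * (lnlnPlus x + L)) := by
        have : 0 ≤ x * (lnlnPlus x + L) := by positivity
        linarith
  have h5 : lnlnPlus x ≤ √(x * (lnlnPlus x + L)) := by
    refine Real.le_sqrt_of_sq_le ?_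
    rw [sq]
    exact mul_le_mul (lnlnPlus_le_self hx1) (by linarith) (by linarith) (by linarith)
  unfold devBound
  linarith

/-- A law of the iterated logarithm with finite sample guarantee: for i.i.d. bounded variables with
second moment at most `v` and mean at most zero, all partial sums are below the deviation bound at
`n * v + 1`, except with probability `δ`. -/
theorem measure_exists_devBound_lt_sum_le [IsProbabilityMeasure μ] {Z : ℕ → Ω → ℝ}
    (hZ : ∀ i, Measurable (Z i)) (hind : iIndepFun Z μ)
    (hid : ∀ i, IdentDistrib (Z i) (Z 0) μ μ) (hb : ∀ᵐ ω ∂μ, |Z 0 ω| ≤ 4)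
    (hmean : ∫ ω, Z 0 ω ∂μ ≤ 0) {v : ℝ} (hv : ∫ ω, Z 0 ω ^ 2 ∂μ ≤ v) {δ : ℝ} (hδ : 0 < δ)
    (hδ1 : δ ≤ 1) :
    μ {ω | ∃ n : ℕ, 22 * devBound (n * v + 1) (Real.log (1 / δ)) <
      ∑ i ∈ Finset.range n, Z i ω} ≤ ENNReal.ofReal δ := by
  set L := Real.log (1 / δ) with hLdef
  have hL : 0 ≤ L := Real.log_nonneg (by rw [le_div_iff₀ hδ]; linarith)
  have hv0 : 0 ≤ v := (integral_nonneg fun ω => sq_nonneg _).trans hv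
  have hsub : {ω | ∃ n : ℕ, 22 * devBound (n * v + 1) L < ∑ i ∈ Finset.range n, Z i ω} ⊆
      ⋃ k : ℕ, {ω | ∃ n : ℕ, scaleLog L k ≤ scaleExponent L k * (∑ i ∈ Finset.range n, Z i ω) -
        n * (scaleExponent L k ^ 2 * v)} := by
    rintro ω ⟨n, hn⟩
    by_contra hcon
    simp only [mem_iUnion, mem_ofPred_eq, not_exists, not_le] at hcon
    exact absurd (le_devBound_of_scales hL hv0 fun k => hcon k n) (not_le.2 hn)
  refine (measure_mono hsub).trans ((measure_iUnion_le _).trans ?_)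
  have hk : ∀ k : ℕ, μ {ω | ∃ n : ℕ, scaleLog L k ≤
      scaleExponent L k * (∑ i ∈ Finset.range n, Z i ω) - n * (scaleExponent L k ^ 2 * v)} ≤
      ENNReal.ofReal (δ * (1 / ((k + 1) * (k + 2)))) := by
    intro k
    have h1 := lintegral_exp_le_one (hZ 0) hb hmean hv (scaleExponent_pos hL k).le
      (min_le_left _ _)
    refine (measure_exists_le_sum_le hZ hind hid h1 _).trans_eq ?_
    congr 1
    rw [scaleLog, hLdef, Real.log_div one_ne_zero hδ.ne', Real.log_one,
      show -(0 - Real.log δ + Real.log (((k : ℝ) + 1) * (k + 2))) =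
        Real.log δ - Real.log (((k : ℝ) + 1) * (k + 2)) by ring,
      Real.exp_sub, Real.exp_log hδ, Real.exp_log (by positivity), mul_one_div]
  refine (ENNReal.tsum_le_tsum hk).trans ?_
  refine ENNReal.tsum_le_of_sum_range_le fun n => ?_
  rw [← ENNReal.ofReal_sum_of_nonneg fun k _ => by positivity, ← Finset.mul_sum]
  refine ENNReal.ofReal_le_ofReal ?_
  have := sum_inv_mul_succ_le_one n
  nlinarith

end Concentration

/-! ### Existence of the two concentration constants -/

/-- To bound the probability of a set from below it suffices to bound that of a superset of its
complement from above; no measurability is needed. -/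
theorem one_sub_le_measureReal {Ω : Type*} [MeasurableSpace Ω] {μ : Measure Ω}
    [IsProbabilityMeasure μ] {G B : Set Ω} {δ : ℝ} (hδ : 0 ≤ δ) (hGB : Gᶜ ⊆ B)
    (hB : μ B ≤ ENNReal.ofReal δ) : 1 - δ ≤ μ.real G := by
  have h1 : μ.real univ ≤ μ.real (G ∪ B) :=
    measureReal_mono (fun ω _ => by
      by_cases h : ω ∈ G
      · exact Or.inl h
      · exact Or.inr (hGB h))
  have h2 := measureReal_union_le (μ := μ) G B
  have h3 : μ.real B ≤ δ := ENNReal.toReal_le_of_le_ofReal hδ hB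
  rw [probReal_univ] at h1
  linarith

theorem sum_firstN (X : ℕ → ℝ) (n : ℕ) : (firstN X n).sum = ∑ i ∈ Finset.range n, X i := by
  induction n with
  | zero => simp [firstN]
  | succ n ih =>
    rw [Finset.sum_range_succ, ← ih]
    simp [firstN, List.range_succ]

theorem length_firstN (X : ℕ → ℝ) (n : ℕ) : (firstN X n).length = n := by simp [firstN]

theorem map_firstN (g : ℝ → ℝ) (X : ℕ → ℝ) (n : ℕ) :
    (firstN X n).map g = firstN (fun i => g (X i)) n := by simp [firstN]

theorem empVar_firstN (X : ℕ → ℝ) (n : ℕ) : empVar (firstN X n) = (n : ℝ) / (n - 1) *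
    (∑ i ∈ Finset.range n, X i ^ 2 - (∑ i ∈ Finset.range n, X i) ^ 2 / n) := by
  rw [empVar, length_firstN, map_firstN, sum_firstN, sum_firstN]

namespace IsCenteredIID

variable {Ω : Type} [MeasurableSpace Ω] {μ : Measure Ω} {X : ℕ → Ω → ℝ}

theorem neg (h : IsCenteredIID μ X) : IsCenteredIID μ fun i ω => -X i ω where
  measurable i := (h.measurable i).neg
  indep := h.indep.comp (fun _ x => -x) fun _ => measurable_neg
  identDistrib i := (h.identDistrib i).comp measurable_neg
  bounded := by
    filter_upwards [h.bounded] with ω hω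
    exact ⟨by linarith [hω.2], by linarith [hω.1]⟩
  mean := by rw [integral_neg, h.mean, neg_zero]

variable [IsProbabilityMeasure μ]

theorem integrable_sq (h : IsCenteredIID μ X) : Integrable (fun ω => X 0 ω ^ 2) μ := by
  refine Integrable.of_bound ((h.measurable 0).pow_const 2).aestronglyMeasurable 4 ?_
  filter_upwards [h.bounded] with ω hω
  rw [Real.norm_eq_abs, abs_of_nonneg (sq_nonneg _)]
  nlinarith [hω.1, hω.2]

theorem integral_sq_le (h : IsCenteredIID μ X) : ∫ ω, X 0 ω ^ 2 ∂μ ≤ 4 := by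
  have : ∫ ω, X 0 ω ^ 2 ∂μ ≤ ∫ _, (4 : ℝ) ∂μ := by
    refine integral_mono_ae h.integrable_sq (integrable_const _) ?_
    filter_upwards [h.bounded] with ω hω
    show X 0 ω ^ 2 ≤ 4
    nlinarith [hω.1, hω.2]
  simpa using this

theorem measure_sum_gt_le (h : IsCenteredIID μ X) {v δ : ℝ} (hv : ∫ ω, X 0 ω ^ 2 ∂μ ≤ v)
    (hδ : 0 < δ) (hδ1 : δ ≤ 1) :
    μ {ω | ∃ n : ℕ, 22 * devBound (n * v + 1) (Real.log (1 / δ)) <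
      ∑ i ∈ Finset.range n, X i ω} ≤ ENNReal.ofReal δ := by
  refine measure_exists_devBound_lt_sum_le h.measurable h.indep h.identDistrib ?_ h.mean.le hv
    hδ hδ1
  filter_upwards [h.bounded] with ω hω
  exact abs_le.2 ⟨by linarith [hω.1], by linarith [hω.2]⟩

/-- The squares are bounded below as well: `σ² - X²` has second moment at most `4 σ²`. -/
theorem measure_sum_sq_lt_le (h : IsCenteredIID μ X) {δ : ℝ} (hδ : 0 < δ) (hδ1 : δ ≤ 1) :
    μ {ω | ∃ n : ℕ, 22 * devBound (n * (4 * ∫ ω, X 0 ω ^ 2 ∂μ) + 1) (Real.log (1 / δ)) <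
      ∑ i ∈ Finset.range n, (∫ ω, X 0 ω ^ 2 ∂μ - X i ω ^ 2)} ≤ ENNReal.ofReal δ := by
  set s := ∫ ω, X 0 ω ^ 2 ∂μ with hs
  have hg : Measurable fun x : ℝ => s - x ^ 2 := by fun_prop
  have hs0 : 0 ≤ s := integral_nonneg fun ω => sq_nonneg _
  have hs4 : s ≤ 4 := h.integral_sq_le
  have hpt : ∀ᵐ ω ∂μ, 0 ≤ X 0 ω ^ 2 ∧ X 0 ω ^ 2 ≤ 4 := by
    filter_upwards [h.bounded] with ω hω
    exact ⟨sq_nonneg _, by nlinarith [hω.1, hω.2]⟩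
  have hb : ∀ᵐ ω ∂μ, |s - X 0 ω ^ 2| ≤ 4 := by
    filter_upwards [hpt] with ω hω
    exact abs_le.2 ⟨by linarith, by linarith⟩
  refine measure_exists_devBound_lt_sum_le (Z := fun i ω => s - X i ω ^ 2)
    (fun i => hg.comp (h.measurable i)) (h.indep.comp (fun _ => _) fun _ => hg)
    (fun i => (h.identDistrib i).comp hg) hb ?_ ?_ hδ hδ1
  · rw [integral_sub (integrable_const _) h.integrable_sq]
    simp [hs]
  · have hmono : ∫ ω, (s - X 0 ω ^ 2) ^ 2 ∂μ ≤
        ∫ ω, (s ^ 2 + (4 - 2 * s) * X 0 ω ^ 2) ∂μ := by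
      refine integral_mono_ae ?_ ((integrable_const _).add (h.integrable_sq.const_mul _)) ?_
      · refine Integrable.of_bound (C := 16)
          ((hg.comp (h.measurable 0)).pow_const 2).aestronglyMeasurable ?_
        filter_upwards [hb] with ω hω
        rw [Real.norm_eq_abs, abs_pow]
        nlinarith [abs_nonneg (s - X 0 ω ^ 2)]
      · filter_upwards [hpt] with ω hω
        show (s - X 0 ω ^ 2) ^ 2 ≤ s ^ 2 + (4 - 2 * s) * X 0 ω ^ 2
        nlinarith [hω.1, hω.2]
    refine hmono.trans ?_
    rw [integral_add (integrable_const _) (h.integrable_sq.const_mul _), integral_const_mul, ← hs]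
    simp only [integral_const, probReal_univ, one_smul]
    nlinarith

end IsCenteredIID

theorem log_inv_div {δ c : ℝ} (hδ : 0 < δ) (hc : 0 < c) :
    Real.log (1 / (δ / c)) = Real.log (1 / δ) + Real.log c := by
  rw [show 1 / (δ / c) = 1 / δ * c by field_simp, Real.log_mul (by positivity) hc.ne']

theorem log_inv_nonneg {δ : ℝ} (hδ : 0 < δ) (hδ1 : δ ≤ 1) : 0 ≤ Real.log (1 / δ) :=
  Real.log_nonneg (by rw [le_div_iff₀ hδ]; linarith)

theorem exists_isUniformConst : ∃ D₀ : ℝ, IsUniformConst D₀ := by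
  refine ⟨22 * (2 * 5), fun Ω _ μ _ X hX δ hδ hδ1 => ?_⟩
  have hL := log_inv_nonneg hδ hδ1.le
  have h1 := hX.measure_sum_gt_le hX.integral_sq_le (half_pos hδ) (by linarith)
  have h2 := hX.neg.measure_sum_gt_le hX.neg.integral_sq_le (half_pos hδ) (by linarith)
  -- each tail gets half of `δ`; the factor `5` comes from `n * 4 + 1 ≤ 5 * (4 * n)`
  refine one_sub_le_measureReal hδ.le ?_
    ((measure_union_le _ _).trans (add_le_add h1 h2) |>.trans ?_)
  · rintro ω hω
    simp only [mem_compl_iff, mem_ofPred_eq, not_forall, not_le] at hω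
    obtain ⟨n, hn, hlt⟩ := hω
    have hn1 : (1 : ℝ) ≤ n := by exact_mod_cast hn
    have hbd : 22 * devBound (n * 4 + 1) (Real.log (1 / (δ / 2))) ≤
        pThreshold (22 * (2 * 5)) n δ := by
      rw [pThreshold_eq, mul_assoc, log_inv_div hδ two_pos]
      gcongr
      refine (devBound_mono (by positivity) ?_ ?_ le_rfl).trans
        (devBound_mul_add_le (C := 5) (by norm_num) ?_ (by positivity) hL)
      · linarith
      · have := Real.log_nonneg (one_le_two (α := ℝ))
        linarith
      · have := Real.log_two_lt_d9
        linarith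
    rw [sum_firstN] at hlt
    rcases lt_abs.1 hlt with h | h
    · exact Or.inl ⟨n, hbd.trans_lt h⟩
    · refine Or.inr ⟨n, hbd.trans_lt ?_⟩
      rwa [Finset.sum_neg_distrib]
  · rw [← ENNReal.ofReal_add (by linarith) (by linarith), add_halves]

theorem empVar_firstN_nonneg (X : ℕ → ℝ) {n : ℕ} (hn : 0 < n) : 0 ≤ empVar (firstN X n) := by
  have hn1 : (1 : ℝ) ≤ n := by exact_mod_cast hn
  rw [empVar_firstN]
  refine mul_nonneg (div_nonneg (by linarith) (by linarith)) (sub_nonneg.2 ?_)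
  rw [div_le_iff₀ (by linarith)]
  have := sq_sum_le_card_mul_sum_sq (s := Finset.range n) (f := X)
  rw [Finset.card_range] at this
  linarith

theorem sub_le_empVar_firstN (X : ℕ → ℝ) {n : ℕ} (hn : 1 < n) :
    ∑ i ∈ Finset.range n, X i ^ 2 - (∑ i ∈ Finset.range n, X i) ^ 2 / n ≤
      empVar (firstN X n) := by
  have hn1 : (1 : ℝ) < n := by exact_mod_cast hn
  rw [empVar_firstN]
  refine le_mul_of_one_le_left (sub_nonneg.2 ?_) ?_
  · rw [div_le_iff₀ (by linarith)]
    have := sq_sum_le_card_mul_sum_sq (s := Finset.range n) (f := X)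
    rw [Finset.card_range] at this
    linarith
  · rw [le_div_iff₀ (by linarith)]
    linarith

/-- On the event that the partial sums of `X` and of `σ² - X²` obey the deviation bound, the true
variance `n σ²` is dominated by the empirical one, up to a term of order `L + 1`. The assumption
`L ≤ n` absorbs the contribution of the squared empirical mean. -/
theorem exists_variance_le_empVar : ∃ C : ℝ, 2 ≤ C ∧ ∀ (X : ℕ → ℝ) (n : ℕ) (s L M : ℝ),
    0 < n → 0 ≤ s → s ≤ 4 → 0 ≤ L → L ≤ n → L ≤ M → M ≤ L + 2 →
    |∑ i ∈ Finset.range n, X i| ≤ 22 * devBound (n * (4 * s) + 1) M →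
    ∑ i ∈ Finset.range n, (s - X i ^ 2) ≤ 22 * devBound (n * (4 * s) + 1) M →
    n * (4 * s) + 1 ≤ C * (empVar (firstN X n) + L + 1) := by
  obtain ⟨K₁, hK₁0, hK₁⟩ := exists_devBound_le_linear (η := 1 / 200000) (by norm_num)
  obtain ⟨K₂, hK₂0, hK₂⟩ := exists_lnlnPlus_le_linear (η := 1 / 200000) (by norm_num)
  refine ⟨1000000 * (1 + K₁ + K₂), by linarith, fun X n s L M hn hs hs4 hL hLn hLM hML hS hQ => ?_⟩
  have hn1 : (1 : ℝ) ≤ n := by exact_mod_cast hn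
  have hV := empVar_firstN_nonneg X hn
  have hns : 0 ≤ n * (4 * s) := by positivity
  rcases Nat.lt_or_ge 1 n with hn2 | hn2
  swap
  · -- For `n = 1` the empirical variance vanishes, but the true one is bounded.
    have hn' : n = 1 := by omega
    subst hn'
    push_cast
    nlinarith
  have hVQ := sub_le_empVar_firstN X hn2
  set V := empVar (firstN X n)
  set S := ∑ i ∈ Finset.range n, X i
  rw [Finset.sum_sub_distrib] at hQ
  simp only [Finset.sum_const, Finset.card_range, nsmul_eq_mul] at hQ
  set Q := ∑ i ∈ Finset.range n, X i ^ 2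
  set x := n * (4 * s) + 1 with hx
  have hx1 : 1 ≤ x := by linarith
  have hM : 0 ≤ M := hL.trans hLM
  have hll := one_le_lnlnPlus x
  have h1 := hK₁ x M (by linarith) hM
  have h2 := hK₂ x (by linarith)
  have hd := one_le_devBound (x := x) hM
  have hdsq : devBound x M ^ 2 ≤ 2 * (1 + M) ^ 2 + 2 * (x * (lnlnPlus x + M)) := by
    have h3 : √(x * (lnlnPlus x + M)) ^ 2 = x * (lnlnPlus x + M) := Real.sq_sqrt (by positivity)
    unfold devBound
    nlinarith [sq_nonneg (1 + M - √(x * (lnlnPlus x + M)))]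
  have hSsq : S ^ 2 ≤ 484 * devBound x M ^ 2 := by
    rw [← sq_abs S]
    nlinarith [abs_nonneg S]
  have hSn : S ^ 2 / n ≤ 484 * (36 * (1 + L) + 34 * (lnlnPlus x + M)) := by
    rw [div_le_iff₀ (by linarith)]
    have h4 : (1 + M) ^ 2 ≤ 18 * (1 + L) * n := by
      calc (1 + M) ^ 2 ≤ (3 * (1 + L)) ^ 2 := by gcongr; linarith
        _ = 9 * (1 + L) * (1 + L) := by ring
        _ ≤ 9 * (1 + L) * (2 * n) := by gcongr; linarith
        _ = _ := by ring
    have h5 : x * (lnlnPlus x + M) ≤ 17 * n * (lnlnPlus x + M) := by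
      gcongr
      nlinarith
    linarith
  -- Both error terms are sublinear in `x`, with total slope below `1 / 2`.
  have h6 : x ≤ 4 * V + 4 * (S ^ 2 / n) + 88 * devBound x M + 1 := by linarith
  have h7 : K₁ * (1 + M) ≤ K₁ * (3 * (1 + L)) := by gcongr; linarith
  have h8 : 0 ≤ K₂ * L := by positivity
  have h9 : 0 ≤ K₁ * L := by positivity
  have h10 : 0 ≤ K₁ * V := by positivity
  have h11 : 0 ≤ K₂ * V := by positivity
  linarith

theorem exists_isUniformEmpiricalConst : ∃ D₁ : ℝ, IsUniformEmpiricalConst D₁ := by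
  obtain ⟨C, hC2, hC⟩ := exists_variance_le_empVar
  refine ⟨22 * (2 * C), fun Ω _ μ _ X hX δ hδ hδ1 => ?_⟩
  have hL := log_inv_nonneg hδ hδ1.le
  have hlog3 : 0 ≤ Real.log 3 := Real.log_nonneg (by norm_num)
  have hlog3' : Real.log 3 ≤ 2 := by
    have := Real.log_le_sub_one_of_pos (x := 3) (by norm_num)
    linarith
  have hδ3 : 0 < δ / 3 := by positivity
  have hv : ∫ ω, X 0 ω ^ 2 ∂μ ≤ 4 * ∫ ω, X 0 ω ^ 2 ∂μ := by
    have : 0 ≤ ∫ ω, X 0 ω ^ 2 ∂μ := integral_nonneg fun ω => sq_nonneg _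
    linarith
  have h1 := hX.measure_sum_gt_le hv hδ3 (by linarith)
  have h2 := hX.neg.measure_sum_gt_le (v := 4 * ∫ ω, X 0 ω ^ 2 ∂μ) (by simpa using hv) hδ3
    (by linarith)
  have h3 := hX.measure_sum_sq_lt_le hδ3 (by linarith)
  refine one_sub_le_measureReal hδ.le ?_
    ((measure_union_le _ _).trans (add_le_add ((measure_union_le _ _).trans (add_le_add h1 h2)) h3)
      |>.trans ?_)
  · intro ω hω
    by_contra hcon
    simp only [mem_union, mem_ofPred_eq, not_or, not_exists, not_lt] at hcon
    obtain ⟨⟨hc1, hc2⟩, hc3⟩ := hcon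
    refine hω fun n hn hLn => ?_
    rw [log_inv_div hδ three_pos] at hc1 hc2 hc3
    have habs : |∑ i ∈ Finset.range n, X i ω| ≤
        22 * devBound (n * (4 * ∫ ω, X 0 ω ^ 2 ∂μ) + 1) (Real.log (1 / δ) + Real.log 3) := by
      have := hc2 n
      rw [Finset.sum_neg_distrib] at this
      exact abs_le.2 ⟨by linarith, hc1 n⟩
    have hs0 : 0 ≤ ∫ ω, X 0 ω ^ 2 ∂μ := integral_nonneg fun ω => sq_nonneg _
    have hx := hC (fun i => X i ω) n _ _ _ hn hs0 hX.integral_sq_le hL hLn (by linarith)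
      (by linarith) habs (hc3 n)
    have hV := empVar_firstN_nonneg (fun i => X i ω) hn
    rw [sum_firstN, qThreshold_eq, mul_assoc]
    refine habs.trans ?_
    gcongr
    exact (devBound_mono (by positivity) (hx.trans_eq (by ring)) (by positivity) le_rfl).trans
      (devBound_mul_add_le (by linarith) (by linarith) (by positivity) hL)
  · rw [← ENNReal.ofReal_add (by linarith) (by linarith),
      ← ENNReal.ofReal_add (by linarith) (by linarith)]
    exact ENNReal.ofReal_le_ofReal (by linarith)

/-! ### Failure probabilities of the two tests -/

theorem measure_compl_le_of_one_sub_le {Ω : Type*} [MeasurableSpace Ω] {μ : Measure Ω}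
    [IsProbabilityMeasure μ] {G : Set Ω} (hG : MeasurableSet G) {δ : ℝ}
    (h : 1 - δ ≤ μ.real G) : μ Gᶜ ≤ ENNReal.ofReal δ := by
  rw [← ofReal_measureReal (measure_ne_top μ _), probReal_compl_eq_one_sub hG]
  exact ENNReal.ofReal_le_ofReal (by linarith)

theorem measurable_lnlnPlus : Measurable lnlnPlus := by
  unfold lnlnPlus
  fun_prop

theorem measurable_qThreshold (D δ : ℝ) : Measurable fun v => qThreshold D v δ := by
  have := measurable_lnlnPlus
  unfold qThreshold
  fun_prop

section

variable {Ω : Type} [MeasurableSpace Ω] {μ : Measure Ω} [IsProbabilityMeasure μ] {X : ℕ → Ω → ℝ}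

theorem IsUniformConst.measure_le {D₀ : ℝ} (hD : IsUniformConst D₀) (hX : IsCenteredIID μ X)
    {δ : ℝ} (hδ : 0 < δ) (hδ1 : δ < 1) :
    μ {ω | ∃ n : ℕ, 0 < n ∧ pThreshold D₀ n δ < |∑ i ∈ Finset.range n, X i ω|} ≤
      ENNReal.ofReal δ := by
  have hm := hX.measurable
  have h := hD Ω μ X hX δ hδ hδ1
  simp only [sum_firstN] at h
  refine (measure_mono ?_).trans (measure_compl_le_of_one_sub_le ?_ h)
  · rintro ω ⟨n, hn, hlt⟩ hω
    exact absurd (hω n hn) (not_le.2 hlt)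
  · refine Measurable.setOf (Measurable.forall fun n => Measurable.imp measurable_const ?_)
    exact measurableSet_setOfPred.1 (measurableSet_le (by fun_prop) measurable_const)

theorem IsUniformEmpiricalConst.measure_le {D₁ : ℝ} (hD : IsUniformEmpiricalConst D₁)
    (hX : IsCenteredIID μ X) {δ : ℝ} (hδ : 0 < δ) (hδ1 : δ < 1) :
    μ {ω | ∃ n : ℕ, 0 < n ∧ Real.log (1 / δ) ≤ n ∧
      qThreshold D₁ (empVar (firstN (fun i => X i ω) n)) δ < |∑ i ∈ Finset.range n, X i ω|} ≤
      ENNReal.ofReal δ := by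
  have hm := hX.measurable
  have h := hD Ω μ X hX δ hδ hδ1
  simp only [sum_firstN] at h
  refine (measure_mono ?_).trans (measure_compl_le_of_one_sub_le ?_ h)
  · rintro ω ⟨n, hn, hln, hlt⟩ hω
    exact absurd (hω n hn hln) (not_le.2 hlt)
  · refine Measurable.setOf (Measurable.forall fun n => Measurable.imp measurable_const
      (Measurable.imp measurable_const ?_))
    refine measurableSet_setOfPred.1 (measurableSet_le (by fun_prop) ?_)
    refine (measurable_qThreshold D₁ δ).comp ?_
    simp only [empVar_firstN]
    fun_prop

end

/-- A function of the coordinates of an infinite product of copies of one space is i.i.d. -/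
theorem isCenteredIID_infinitePi {β : Type} [MeasurableSpace β] (ν : Measure β)
    [IsProbabilityMeasure ν] {g : β → ℝ} (hg : Measurable g) (hb : ∀ b, g b ∈ Icc (-2 : ℝ) 2)
    (hmean : ∫ b, g b ∂ν = 0) :
    IsCenteredIID (Measure.infinitePi fun _ : ℕ => ν) (fun i ω => g (ω i)) where
  measurable i := hg.comp (measurable_pi_apply i)
  indep := iIndepFun_infinitePi (X := fun _ => g) fun _ => hg
  identDistrib i := by
    refine IdentDistrib.comp (f := fun ω : ℕ → β => ω i) (g := fun ω : ℕ → β => ω 0)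
      ⟨(measurable_pi_apply i).aemeasurable, (measurable_pi_apply 0).aemeasurable, ?_⟩ hg
    rw [Measure.infinitePi_map_eval (fun _ : ℕ => ν) i,
      Measure.infinitePi_map_eval (fun _ : ℕ => ν) 0]
  bounded := Filter.Eventually.of_forall fun ω => hb _
  mean := by
    rw [← hmean]
    have h := Measure.infinitePi_map_eval (fun _ : ℕ => ν) 0
    conv_rhs => rw [← h]
    rw [integral_map (measurable_pi_apply 0).aemeasurable hg.aestronglyMeasurable]

theorem abs_signOf (b : Bool) : |signOf b| = 1 := by cases b <;> simp [signOf]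

/-- The constant `D₀` is positive: the first step of a simple random walk has modulus `1`. -/
theorem IsUniformConst.pos {D₀ : ℝ} (hD : IsUniformConst D₀) : 0 < D₀ := by
  have hX : IsCenteredIID
      (Measure.infinitePi fun _ : ℕ => (PMF.uniformOfFintype Bool).toMeasure)
      (fun i ω => signOf (ω i)) := by
    refine isCenteredIID_infinitePi _ (measurable_of_countable _) (fun b => ?_) ?_
    · cases b <;> norm_num [signOf]
    · rw [PMF.integral_eq_sum]
      simp [signOf]
  have h := hD _ _ _ hX (1 / 2) (by norm_num) (by norm_num)
  have hne : ∃ ω : ℕ → Bool, ∀ n : ℕ, 0 < n →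
      |(firstN (fun i => signOf (ω i)) n).sum| ≤ pThreshold D₀ n (1 / 2) := by
    by_contra hcon
    push Not at hcon
    rw [show {ω : ℕ → Bool | ∀ n : ℕ, 0 < n →
      |(firstN (fun i => signOf (ω i)) n).sum| ≤ pThreshold D₀ n (1 / 2)} = ∅ from
      eq_empty_of_forall_notMem fun ω hω => by
        obtain ⟨n, hn, hlt⟩ := hcon ω
        exact absurd (hω n hn) (not_le.2 hlt), measureReal_empty] at h
    norm_num at h
  obtain ⟨ω, hω⟩ := hne
  have h1 := hω 1 one_pos
  rw [sum_firstN, Finset.sum_range_one, abs_signOf, pThreshold_eq] at h1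
  have h2 := one_le_devBound (x := 4 * ((1 : ℕ) : ℝ))
    (log_inv_nonneg (δ := 1 / 2) (by norm_num) (by norm_num))
  by_contra hcon
  nlinarith

theorem pThreshold_pos {D₀ : ℝ} (hD : 0 < D₀) (n : ℕ) {δ : ℝ} (hδ : 0 < δ) (hδ1 : δ ≤ 1) :
    0 < pThreshold D₀ n δ := by
  rw [pThreshold_eq]
  have := one_le_devBound (x := 4 * (n : ℝ)) (log_inv_nonneg hδ hδ1)
  positivity

/-- For steps in `[-1, 1]` of mean at most zero, the walk reaches the threshold with probability at
most `δ`. If the mean is zero, the event that the walk equals the threshold is excluded by applying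
the concentration inequality to the doubled steps, which still lie in `[-2, 2]`. -/
theorem IsUniformConst.measure_exists_pThreshold_le {D₀ : ℝ} (hD : IsUniformConst D₀) {β : Type}
    [MeasurableSpace β] (ν : Measure β) [IsProbabilityMeasure ν] {g : β → ℝ} (hg : Measurable g)
    (hb : ∀ b, g b ∈ Icc (-1 : ℝ) 1) (hmean : ∫ b, g b ∂ν ≤ 0) {δ : ℝ} (hδ : 0 < δ)
    (hδ1 : δ < 1) :
    (Measure.infinitePi fun _ : ℕ => ν)
      {ω | ∃ n : ℕ, pThreshold D₀ n δ ≤ ∑ i ∈ Finset.range n, g (ω i)} ≤ ENNReal.ofReal δ := by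
  have hgi : Integrable g ν := Integrable.of_bound hg.aestronglyMeasurable 1
    (Filter.Eventually.of_forall fun b => abs_le.2 (hb b))
  have hpos : ∀ (ω : ℕ → β) (n : ℕ), pThreshold D₀ n δ ≤ ∑ i ∈ Finset.range n, g (ω i) →
      0 < n := fun ω n hn => by
    have hp := pThreshold_pos hD.pos n hδ hδ1.le
    rcases n.eq_zero_or_pos with h0 | h0
    · subst h0
      simp only [Finset.range_zero, Finset.sum_empty] at hn
      linarith
    · exact h0
  rcases hmean.lt_or_eq with hlt | heq
  · set m := ∫ b, g b ∂ν with hm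
    have hm1 : -1 ≤ m := by
      have : ∫ _, (-1 : ℝ) ∂ν ≤ ∫ b, g b ∂ν :=
        integral_mono (integrable_const _) hgi fun b => (hb b).1
      simpa using this
    have hX : IsCenteredIID (Measure.infinitePi fun _ : ℕ => ν) (fun i ω => g (ω i) - m) := by
      refine isCenteredIID_infinitePi ν (g := fun b => g b - m) (by fun_prop) (fun b => ?_) ?_
      · exact ⟨by linarith [(hb b).1], by linarith [(hb b).2]⟩
      · rw [integral_sub hgi (integrable_const _)]
        simp [hm]
    refine (measure_mono ?_).trans (hD.measure_le hX hδ hδ1)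
    rintro ω ⟨n, hn⟩
    have hn0 := hpos ω n hn
    refine ⟨n, hn0, lt_of_lt_of_le ?_ (le_abs_self _)⟩
    rw [Finset.sum_sub_distrib]
    simp only [Finset.sum_const, Finset.card_range, nsmul_eq_mul]
    have : (n : ℝ) * m < 0 := mul_neg_of_pos_of_neg (by exact_mod_cast hn0) hlt
    linarith
  · have hX : IsCenteredIID (Measure.infinitePi fun _ : ℕ => ν) (fun i ω => 2 * g (ω i)) := by
      refine isCenteredIID_infinitePi ν (g := fun b => 2 * g b) (by fun_prop) (fun b => ?_) ?_
      · exact ⟨by linarith [(hb b).1], by linarith [(hb b).2]⟩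
      · rw [integral_const_mul, heq, mul_zero]
    refine (measure_mono ?_).trans (hD.measure_le hX hδ hδ1)
    rintro ω ⟨n, hn⟩
    have hp := pThreshold_pos hD.pos n hδ hδ1.le
    have hn0 := hpos ω n hn
    refine ⟨n, hn0, lt_of_lt_of_le ?_ (le_abs_self _)⟩
    rw [← Finset.mul_sum]
    linarith

/-! ### Events that depend on a set of coordinates -/

section Coordinates

variable {ι β : Type*} [MeasurableSpace β]

/-- The σ-algebra on `ι → β` generated by the coordinates in `A`. -/
@[reducible]
def coordAlgebra (β : Type*) [MeasurableSpace β] (A : Set ι) : MeasurableSpace (ι → β) :=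
  ⨆ q ∈ A, MeasurableSpace.comap (fun y => y q) inferInstance

theorem coordAlgebra_mono {A B : Set ι} (h : A ⊆ B) : coordAlgebra β A ≤ coordAlgebra β B :=
  biSup_mono h

theorem coordAlgebra_le (A : Set ι) : coordAlgebra β A ≤ MeasurableSpace.pi :=
  iSup₂_le fun q _ => (measurable_pi_apply q).comap_le

theorem indep_coordAlgebra (P : ι → Measure β) [∀ i, IsProbabilityMeasure (P i)] {A B : Set ι}
    (h : Disjoint A B) :
    Indep (coordAlgebra β A) (coordAlgebra β B) (Measure.infinitePi P) := by
  have hind : iIndepFun (fun (i : ι) (y : ι → β) => y i) (Measure.infinitePi P) :=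
    iIndepFun_infinitePi (X := fun _ b => b) fun _ => measurable_id
  exact indep_iSup_of_disjoint (fun q => (measurable_pi_apply q).comap_le) hind.iIndep h

/-- An event that depends on finitely many coordinates, each with values in a finite set, belongs to
the σ-algebra that these coordinates generate. -/
theorem measurableSet_coordAlgebra [Finite β] [MeasurableSingletonClass β] {A : Set ι}
    (J : Finset ι) (hJ : ↑J ⊆ A) {S : Set (ι → β)}
    (h : ∀ y y', (∀ q ∈ J, y q = y' q) → y ∈ S → y' ∈ S) :
    MeasurableSet[coordAlgebra β A] S := by
  have hm : @Measurable _ _ (coordAlgebra β A) _ (fun (y : ι → β) (q : J) => y q) := by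
    refine @measurable_pi_lambda _ _ _ (coordAlgebra β A) _ _ fun q => ?_
    exact (comap_measurable (fun y : ι → β => y q)).mono
      (le_biSup (fun q => MeasurableSpace.comap (fun y : ι → β => y q) inferInstance)
        (hJ q.2)) le_rfl
  have hS : S = (fun (y : ι → β) (q : J) => y q) ⁻¹' ((fun (y : ι → β) (q : J) => y q) '' S) := by
    refine (subset_preimage_image _ _).antisymm ?_
    rintro y' ⟨y, hy, hyy'⟩
    exact h y y' (fun q hq => congrFun hyy' ⟨q, hq⟩) hy
  rw [hS]
  exact hm (toFinite _).measurableSet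

/-- The law of a sequence with finitely many values is determined by the probabilities of the
initial segments. -/
theorem eq_infinitePi_of_cylinders [Finite β] [MeasurableSingletonClass β] (ν : Measure β)
    [IsProbabilityMeasure ν] (ρ : Measure (ℕ → β)) [IsProbabilityMeasure ρ]
    (h : ∀ (r : ℕ → β) (n : ℕ), ρ {y | ∀ i < n, y i = r i} = ∏ i ∈ Finset.range n, ν {r i}) :
    ρ = Measure.infinitePi fun _ => ν := by
  refine IsProjectiveLimit.unique (P := fun I : Finset ℕ => Measure.pi fun _ : I => ν) ?_
    (Measure.isProjectiveLimit_infinitePi _)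
  rw [isProjectiveLimit_nat_iff (isProjectiveMeasureFamily_pi fun _ : ℕ => ν)]
  intro n
  refine Measure.ext_of_singleton fun f => ?_
  rw [Measure.map_apply (by fun_prop) (measurableSet_singleton _), Measure.pi_singleton]
  have hβ : Nonempty β := ⟨f ⟨0, by simp⟩⟩
  obtain ⟨b₀⟩ := hβ
  set r : ℕ → β := fun i => if hi : i ∈ Finset.Iic n then f ⟨i, hi⟩ else b₀ with hr
  have hpre : Preorder.frestrictLe (π := fun _ : ℕ => β) n ⁻¹' {f} =
      {y : ℕ → β | ∀ i < n + 1, y i = r i} := by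
    ext y
    simp only [mem_preimage, mem_singleton_iff, mem_ofPred_eq, funext_iff]
    constructor
    · intro hy i hi
      have hi' : i ∈ Finset.Iic n := Finset.mem_Iic.2 (Nat.lt_succ_iff.1 hi)
      simp only [hr, hi', dite_true]
      exact hy ⟨i, hi'⟩
    · intro hy i
      have := hy i (Nat.lt_succ_of_le (Finset.mem_Iic.1 i.2))
      simp only [hr, i.2, dite_true] at this
      exact this
  rw [hpre, h r (n + 1)]
  have hprod : ∏ i : Finset.Iic n, ν {f i} = ∏ i : Finset.Iic n, ν {r i} := by
    refine Finset.prod_congr rfl fun i _ => ?_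
    simp only [hr, i.2, dite_true]
  rw [hprod, Finset.prod_coe_sort (Finset.Iic n) fun i => ν {r i}]
  refine Finset.prod_congr ?_ fun _ _ => rfl
  ext i
  simp

end Coordinates

/-! ### The sequence of labels that remain when abstentions are skipped -/

/-- The number of labels among the first `n` responses. -/
def labelCount (y : ℕ → Response) (n : ℕ) : ℕ := Nat.count (fun i => (y i).isSome = true) n

theorem labelCount_succ (y : ℕ → Response) (n : ℕ) :
    labelCount y (n + 1) = labelCount y n + if (y n).isSome = true then 1 else 0 :=
  Nat.count_succ _ _

/-- Responses assembled from independent bits: the bits `(true, i)` tell which queries are answered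
and the bits `(false, j)` are the successive labels. -/
def assemble (ω : Bool × ℕ → Bool) (i : ℕ) : Response :=
  if ω (true, i) then some (ω (false, Nat.count (fun m => ω (true, m) = true) i)) else none

theorem isSome_assemble (ω : Bool × ℕ → Bool) (i : ℕ) : (assemble ω i).isSome = ω (true, i) := by
  unfold assemble
  cases ω (true, i) <;> simp

theorem labelCount_assemble (ω : Bool × ℕ → Bool) (n : ℕ) :
    labelCount (assemble ω) n = Nat.count (fun m => ω (true, m) = true) n := by
  simp only [labelCount, isSome_assemble]

theorem labelArray_assemble (ω : Bool × ℕ → Bool) (n : ℕ) :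
    labelArray (assemble ω) n =
      firstN (fun j => signOf (ω (false, j))) (labelCount (assemble ω) n) := by
  induction n with
  | zero => simp [labelArray, firstN, labelCount]
  | succ n ih =>
    have h1 : labelArray (assemble ω) (n + 1) =
        labelArray (assemble ω) n ++ ((assemble ω n).map signOf).toList := by
      rw [labelArray, List.range_succ, List.filterMap_append]
      cases h : (assemble ω n).map signOf <;> simp [labelArray, h]
    rw [h1, ih, labelCount_succ, isSome_assemble]
    by_cases h : ω (true, n) = true
    · simp [h, firstN, List.range_succ, assemble, labelCount_assemble]
    · simp [h, assemble]

theorem labelCount_congr {y r : ℕ → Response} {n : ℕ}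
    (h : ∀ i < n, (y i).isSome = (r i).isSome) : labelCount y n = labelCount r n := by
  induction n with
  | zero => simp [labelCount]
  | succ n ih =>
    rw [labelCount_succ, labelCount_succ, ih fun i hi => h i (hi.trans n.lt_succ_self),
      h n n.lt_succ_self]

/-- The bits that assemble to the responses `r`. If `r` has at most `j` labels, then `Nat.nth` takes a
default value at `j`; `usedBits` leaves out these bits. -/
def bitsOf (r : ℕ → Response) : Bool × ℕ → Bool
  | (true, i) => (r i).isSome
  | (false, j) => (r (Nat.nth (fun i => (r i).isSome = true) j)).getD false

theorem bitsOf_labelCount (r : ℕ → Response) (n : ℕ) (h : (r n).isSome = true) :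
    bitsOf r (false, labelCount r n) = (r n).getD false := by
  have : Nat.nth (fun i => (r i).isSome = true) (labelCount r n) = n :=
    Nat.nth_count (p := fun i => (r i).isSome = true) h
  rw [bitsOf, this]

/-- The bits that determine the first `n` assembled responses, given that these are those of `r`. -/
def usedBits (r : ℕ → Response) (n : ℕ) : Finset (Bool × ℕ) :=
  ({true} ×ˢ Finset.range n) ∪ ({false} ×ˢ Finset.range (labelCount r n))

theorem mem_usedBits {r : ℕ → Response} {n : ℕ} {q : Bool × ℕ} :
    q ∈ usedBits r n ↔ (q.1 = true ∧ q.2 < n) ∨ (q.1 = false ∧ q.2 < labelCount r n) := by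
  obtain ⟨b, j⟩ := q
  cases b <;> simp [usedBits]

theorem assemble_eq_iff (r : ℕ → Response) (n : ℕ) (ω : Bool × ℕ → Bool) :
    (∀ i < n, assemble ω i = r i) ↔ ∀ q ∈ usedBits r n, ω q = bitsOf r q := by
  induction n with
  | zero => simp [mem_usedBits, labelCount]
  | succ n ih =>
    have hL : (∀ i < n + 1, assemble ω i = r i) ↔
        (∀ i < n, assemble ω i = r i) ∧ assemble ω n = r n := Nat.forall_lt_succ_right
    have hR : (∀ q ∈ usedBits r (n + 1), ω q = bitsOf r q) ↔
        (∀ q ∈ usedBits r n, ω q = bitsOf r q) ∧ (ω (true, n) = (r n).isSome ∧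
          ((r n).isSome = true → ω (false, labelCount r n) = (r n).getD false)) := by
      constructor
      · intro h
        refine ⟨fun q hq => h q ?_, ?_, fun hs => ?_⟩
        · rw [mem_usedBits] at hq ⊢
          rw [labelCount_succ]
          exact hq.imp (And.imp_right fun h => by omega) (And.imp_right fun h => by omega)
        · exact h (true, n) (mem_usedBits.2 (Or.inl ⟨rfl, n.lt_succ_self⟩))
        · rw [← bitsOf_labelCount r n hs]
          refine h _ (mem_usedBits.2 (Or.inr ⟨rfl, ?_⟩))
          simp [labelCount_succ, hs]
      · rintro ⟨h1, h2, h3⟩ ⟨b, j⟩ hq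
        rw [mem_usedBits] at hq
        rcases hq with ⟨hb, hj⟩ | ⟨hb, hj⟩
        · simp only at hb hj
          subst hb
          rcases Nat.lt_succ_iff_lt_or_eq.1 hj with hj | rfl
          · exact h1 _ (mem_usedBits.2 (Or.inl ⟨rfl, hj⟩))
          · exact h2
        · simp only at hb hj
          subst hb
          by_cases hj' : j < labelCount r n
          · exact h1 _ (mem_usedBits.2 (Or.inr ⟨rfl, hj'⟩))
          · rw [labelCount_succ] at hj
            by_cases hs : (r n).isSome = true
            · have : j = labelCount r n := by rw [if_pos hs] at hj; omega
              rw [this, bitsOf_labelCount r n hs]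
              exact h3 hs
            · rw [if_neg hs] at hj
              omega
    rw [hL, hR, ← ih]
    refine and_congr_right fun h => ?_
    have hc : Nat.count (fun m => ω (true, m) = true) n = labelCount r n := by
      rw [← labelCount_assemble]
      exact labelCount_congr fun i hi => by rw [h i hi]
    unfold assemble
    rw [hc]
    cases hr : r n <;> cases ω (true, n) <;> simp

section LabelLaw

variable (ν : Measure Response)

/-- The law of a label, given that the labeler does not abstain. -/
def labelLaw : Measure Bool := (ProbabilityTheory.cond ν {y | y ≠ none}).map fun y => y.getD false

/-- The laws of the bits from which responses of law `ν` are assembled. -/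
def bitLaw : Bool × ℕ → Measure Bool
  | (true, _) => ν.map Option.isSome
  | (false, _) => labelLaw ν

variable {ν}

theorem labelLaw_apply (S : Set Bool) :
    labelLaw ν S = ProbabilityTheory.cond ν {y | y ≠ none} {y | y.getD false ∈ S} :=
  Measure.map_apply (measurable_of_countable _) S.toFinite.measurableSet

variable [IsProbabilityMeasure ν]

theorem isProbabilityMeasure_labelLaw (h : ν {y | y ≠ none} ≠ 0) :
    IsProbabilityMeasure (labelLaw ν) := by
  have := cond_isProbabilityMeasure h
  exact Measure.isProbabilityMeasure_map (measurable_of_countable _).aemeasurable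

theorem measure_singleton_eq_bits (h : ν {y | y ≠ none} ≠ 0) (y : Response) :
    ν {y} = ν.map Option.isSome {y.isSome} *
      if y.isSome = true then labelLaw ν {y.getD false} else 1 := by
  rw [Measure.map_apply (measurable_of_countable _) (measurableSet_singleton _)]
  cases y with
  | none =>
    simp only [Option.isSome_none, Bool.false_eq_true, if_false, mul_one]
    congr 1
    ext y
    cases y <;> simp
  | some b =>
    have h1 : Option.isSome ⁻¹' {(some b : Response).isSome} = {y : Response | y ≠ none} := by
      ext y
      cases y <;> simp
    have h2 : {y : Response | y ≠ none} ∩ {y | y.getD false ∈ ({(some b).getD false} : Set Bool)} =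
        {some b} := by
      ext y
      cases y <;> simp
    rw [h1, if_pos (by simp), labelLaw_apply, cond_apply (toFinite _).measurableSet, h2,
      ← mul_assoc,
      ENNReal.mul_inv_cancel h (measure_ne_top _ _), one_mul]

theorem isProbabilityMeasure_bitLaw (h : ν {y | y ≠ none} ≠ 0) (q : Bool × ℕ) :
    IsProbabilityMeasure (bitLaw ν q) := by
  obtain ⟨b, j⟩ := q
  cases b
  · exact isProbabilityMeasure_labelLaw h
  · exact Measure.isProbabilityMeasure_map (measurable_of_countable _).aemeasurable

theorem prod_usedBits (h : ν {y | y ≠ none} ≠ 0) (r : ℕ → Response) (n : ℕ) :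
    ∏ q ∈ usedBits r n, bitLaw ν q {bitsOf r q} = ∏ i ∈ Finset.range n, ν {r i} := by
  have hdisj : Disjoint (({true} : Finset Bool) ×ˢ Finset.range n)
      ({false} ×ˢ Finset.range (labelCount r n)) := by
    rw [Finset.disjoint_left]
    simp
  rw [usedBits, Finset.prod_union hdisj, Finset.prod_product, Finset.prod_product,
    Finset.prod_singleton, Finset.prod_singleton]
  clear hdisj
  induction n with
  | zero => simp [labelCount]
  | succ n ih =>
    rw [Finset.prod_range_succ, Finset.prod_range_succ, ← ih, measure_singleton_eq_bits h,
      labelCount_succ]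
    by_cases hs : (r n).isSome = true
    · rw [if_pos hs, if_pos hs, Finset.prod_range_succ, bitsOf_labelCount r n hs]
      simp only [bitLaw, bitsOf]
      ring
    · rw [if_neg hs, if_neg hs]
      simp only [bitLaw, bitsOf, add_zero]
      ring

theorem measurable_assemble : Measurable assemble := by
  refine measurable_pi_lambda _ fun i => ?_
  refine measurable_to_countable' fun y => ?_
  refine coordAlgebra_le univ _ (measurableSet_coordAlgebra
    (Finset.univ ×ˢ Finset.range (i + 1)) (subset_univ _) ?_)
  rintro ω ω' h hω
  have h1 : ∀ b, ∀ j < i + 1, ω (b, j) = ω' (b, j) := fun b j hj => h _ (by simpa using hj)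
  have hc : Nat.count (fun m => ω (true, m) = true) i =
      Nat.count (fun m => ω' (true, m) = true) i := by
    rw [← labelCount_assemble, ← labelCount_assemble]
    refine labelCount_congr fun m hm => ?_
    rw [isSome_assemble, isSome_assemble, h1 true m (by omega)]
  have hle : Nat.count (fun m => ω (true, m) = true) i < i + 1 := Nat.lt_succ_of_le (Nat.count_le _)
  have : assemble ω i = assemble ω' i := by
    unfold assemble
    rw [h1 true i i.lt_succ_self, ← hc, h1 false _ hle]
  rw [mem_preimage, ← this]
  exact hω

/-- Assembling independent answer indicators and independent labels gives independent responses of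
law `ν`. -/
theorem map_assemble (h : ν {y | y ≠ none} ≠ 0) :
    (Measure.infinitePi (bitLaw ν)).map assemble = Measure.infinitePi fun _ : ℕ => ν := by
  have := isProbabilityMeasure_bitLaw h
  have := Measure.isProbabilityMeasure_map (μ := Measure.infinitePi (bitLaw ν))
    measurable_assemble.aemeasurable
  refine eq_infinitePi_of_cylinders ν _ fun r n => ?_
  have hset : MeasurableSet {y : ℕ → Response | ∀ i < n, y i = r i} := by
    refine coordAlgebra_le univ _ (measurableSet_coordAlgebra (Finset.range n) (subset_univ _) ?_)
    intro y y' hyy' hy i hi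
    rw [← hyy' i (Finset.mem_range.2 hi)]
    exact hy i hi
  rw [Measure.map_apply measurable_assemble hset]
  have hpre : assemble ⁻¹' {y : ℕ → Response | ∀ i < n, y i = r i} =
      Set.pi (usedBits r n) fun q => {bitsOf r q} := by
    ext ω
    simp only [mem_preimage, mem_ofPred_eq, assemble_eq_iff]
    rfl
  rw [hpre, Measure.infinitePi_pi _ fun _ _ => measurableSet_singleton _, prod_usedBits h]

/-- The test of the labels errs with probability at most `δ`: if the labels multiplied by the sign
`s` have nonpositive mean, then their partial sums reach the threshold with probability at most
`δ`. -/
theorem IsUniformConst.measure_labelArray_le {D₀ : ℝ} (hD : IsUniformConst D₀)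
    (h : ν {y | y ≠ none} ≠ 0) {s : ℝ} (hs : |s| = 1) (hmean : ∫ b, s * signOf b ∂labelLaw ν ≤ 0)
    {δ : ℝ} (hδ : 0 < δ) (hδ1 : δ < 1) :
    (Measure.infinitePi fun _ : ℕ => ν) {y | ∃ n : ℕ,
      pThreshold D₀ (labelArray y n).length δ ≤ s * (labelArray y n).sum} ≤ ENNReal.ofReal δ := by
  have := isProbabilityMeasure_bitLaw h
  have := isProbabilityMeasure_labelLaw h
  have hmeas : MeasurableSet {y : ℕ → Response | ∃ n : ℕ,
      pThreshold D₀ (labelArray y n).length δ ≤ s * (labelArray y n).sum} := by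
    refine Measurable.setOf (Measurable.exists fun n => measurableSet_setOfPred.1 ?_)
    refine coordAlgebra_le univ _ (measurableSet_coordAlgebra (Finset.range n) (subset_univ _) ?_)
    intro y y' hyy' hy
    have : labelArray y n = labelArray y' n := by
      unfold labelArray
      refine List.filterMap_congr fun i hi => ?_
      rw [hyy' i (Finset.mem_range.2 (List.mem_range.1 hi))]
    rw [mem_ofPred_eq, ← this]
    exact hy
  have hmap : (Measure.infinitePi (bitLaw ν)).map (fun ω j => ω (false, j)) =
      Measure.infinitePi fun _ : ℕ => labelLaw ν :=
    Measure.map_infinitePi_infinitePi_of_inj (P := bitLaw ν) (f := fun j : ℕ => (false, j))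
      (fun i j hij => (Prod.mk.inj hij).2)
  have hb : ∀ b, s * signOf b ∈ Icc (-1 : ℝ) 1 := fun b =>
    abs_le.1 (by rw [abs_mul, hs, abs_signOf, one_mul])
  have key := hD.measure_exists_pThreshold_le (labelLaw ν) (g := fun b => s * signOf b)
    (measurable_of_countable _) hb hmean hδ hδ1
  rw [← map_assemble h, Measure.map_apply measurable_assemble hmeas]
  rw [← hmap] at key
  refine ((measure_mono ?_).trans (Measure.le_map_apply
    (Measurable.aemeasurable (by fun_prop)) _)).trans key
  rintro ω ⟨n, hn⟩
  rw [labelArray_assemble, length_firstN, sum_firstN] at hn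
  refine ⟨_, hn.trans_eq ?_⟩
  rw [Finset.mul_sum]

theorem integral_signOf_labelLaw (h : ν {y | y ≠ none} ≠ 0) (s : ℝ) :
    ∫ b, s * signOf b ∂labelLaw ν = s * (1 - 2 * (labelLaw ν).real {false}) := by
  have := isProbabilityMeasure_labelLaw h
  have h1 := probReal_compl_eq_one_sub (μ := labelLaw ν) (measurableSet_singleton false)
  rw [show ({false}ᶜ : Set Bool) = {true} by ext b; cases b <;> simp] at h1
  rw [integral_fintype (Integrable.of_finite ..)]
  simp [signOf, h1]
  ring

end LabelLaw

/-! ### Events of failure in one round -/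

/-- The concentration inequality of `CheckSignificantVar` fails for the differences of the answer
indicators, whose mean is `g`. -/
def DiffBad (D₁ δ g : ℝ) (y z : ℕ → Response) : Prop :=
  ∃ n : ℕ, 0 < n ∧ Real.log (1 / δ) ≤ n ∧
    qThreshold D₁ (empVar (abstentionDiffs y z n)) δ < |(abstentionDiffs y z n).sum - n * g|

/-- There are far more answers than the rate bound `F` predicts at each of the two points. -/
def CountBad (F δ : ℝ) (y z : ℕ → Response) : Prop :=
  ∃ n : ℕ, 4 * n * F + 2 * Real.log (1 / δ) ≤
    ∑ i ∈ Finset.range n, (nonAbstain (y i) + nonAbstain (z i))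

/-- The labels, multiplied by the sign `s`, pass the test `CheckSignificant` at some time. -/
def LabelBad (D₀ δ s : ℝ) (y : ℕ → Response) : Prop :=
  ∃ n : ℕ, pThreshold D₀ (labelArray y n).length δ ≤ s * (labelArray y n).sum

theorem abstentionDiffs_eq_firstN (y z : ℕ → Response) (n : ℕ) :
    abstentionDiffs y z n = firstN (fun i => nonAbstain (y i) - nonAbstain (z i)) n := rfl

theorem abstentionDiffs_congr {y y' z z' : ℕ → Response} {n : ℕ} (h : ∀ i < n, y i = y' i)
    (h' : ∀ i < n, z i = z' i) : abstentionDiffs y z n = abstentionDiffs y' z' n := by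
  refine List.map_congr_left fun i hi => ?_
  rw [h i (List.mem_range.1 hi), h' i (List.mem_range.1 hi)]

theorem labelArray_congr {y y' : ℕ → Response} {n : ℕ} (h : ∀ i < n, y i = y' i) :
    labelArray y n = labelArray y' n :=
  List.filterMap_congr fun i hi => by rw [h i (List.mem_range.1 hi)]

theorem empVar_firstN_sub (X : ℕ → ℝ) (m : ℝ) {n : ℕ} (hn : 0 < n) :
    empVar (firstN (fun i => X i - m) n) = empVar (firstN X n) := by
  have hn0 : (n : ℝ) ≠ 0 := by exact_mod_cast hn.ne'
  rw [empVar_firstN, empVar_firstN]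
  congr 1
  have h1 : ∑ i ∈ Finset.range n, (X i - m) ^ 2 = ∑ i ∈ Finset.range n, X i ^ 2 -
      2 * m * ∑ i ∈ Finset.range n, X i + n * m ^ 2 := by
    simp only [sub_sq, Finset.sum_add_distrib, Finset.sum_sub_distrib, Finset.mul_sum,
      Finset.sum_const, Finset.card_range, nsmul_eq_mul]
    congr 2
    exact Finset.sum_congr rfl fun i _ => by ring
  rw [h1, Finset.sum_sub_distrib]
  simp only [Finset.sum_const, Finset.card_range, nsmul_eq_mul]
  field_simp
  ring

theorem nonAbstain_mem (y : Response) : nonAbstain y ∈ Icc (0 : ℝ) 1 := by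
  cases y <;> simp [nonAbstain]

theorem integral_nonAbstain (p : PMF Response) :
    ∫ y, nonAbstain y ∂p.toMeasure = 1 - (p none).toReal := by
  have h : nonAbstain = fun y => 1 - ({none} : Set Response).indicator (fun _ => (1 : ℝ)) y := by
    funext y
    cases y <;> simp [nonAbstain]
  rw [h, integral_sub (integrable_const _) (Integrable.of_finite ..),
    integral_indicator_const _ (measurableSet_singleton _), measureReal_def,
    PMF.toMeasure_apply_singleton _ _ (measurableSet_singleton _)]
  simp

section PairLaw

/-- The law of a pair of responses at the points `u` (index `true`) and `m` (index `false`). -/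
def pairLaw (P : Labeler) (u m : ℝ) : Measure (Bool → Response) :=
  Measure.infinitePi fun b : Bool => (P (if b then u else m)).toMeasure

instance (P : Labeler) (u m : ℝ) : IsProbabilityMeasure (pairLaw P u m) := by
  unfold pairLaw
  infer_instance

theorem map_pair_responseLaw (P : Labeler) (k : ℕ) {u m : ℝ} (hum : u ≠ m) :
    (responseLaw P).map (fun Y (i : ℕ) (b : Bool) => Y (k, i, if b then u else m)) =
      Measure.infinitePi fun _ : ℕ => pairLaw P u m := by
  have hinj : Function.Injective fun q : ℕ × Bool =>
      ((k, q.1, if q.2 then u else m) : ℕ × ℕ × ℝ) := by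
    rintro ⟨i, b⟩ ⟨j, b'⟩ h
    simp only [Prod.mk.injEq, true_and] at h
    obtain ⟨rfl, h⟩ := h
    cases b <;> cases b' <;> simp_all
  have h1 := Measure.map_infinitePi_infinitePi_of_inj
    (P := fun q : ℕ × ℕ × ℝ => (P q.2.2).toMeasure) hinj
  have h2 := Measure.infinitePi_map_curry
    (fun (_ : ℕ) (b : Bool) => (P (if b then u else m)).toMeasure)
  have h3 : (fun (Y : ℕ × ℕ × ℝ → Response) (i : ℕ) (b : Bool) => Y (k, i, if b then u else m)) =
      MeasurableEquiv.curry ℕ Bool Response ∘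
        fun Y (q : ℕ × Bool) => Y (k, q.1, if q.2 then u else m) := rfl
  unfold pairLaw
  rw [h3, ← Measure.map_map (by fun_prop) (by fun_prop), responseLaw, h1, h2]

theorem map_single_responseLaw (P : Labeler) (k : ℕ) (u : ℝ) :
    (responseLaw P).map (fun Y (i : ℕ) => Y (k, i, u)) =
      Measure.infinitePi fun _ : ℕ => (P u).toMeasure :=
  Measure.map_infinitePi_infinitePi_of_inj
    (P := fun q : ℕ × ℕ × ℝ => (P q.2.2).toMeasure) (f := fun i : ℕ => ((k, i, u) : ℕ × ℕ × ℝ))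
    fun _ _ hij => (Prod.mk.inj (Prod.mk.inj hij).2).1

theorem integral_pairLaw (P : Labeler) (u m : ℝ) (b : Bool) (g : Response → ℝ) :
    ∫ y, g (y b) ∂pairLaw P u m = ∫ y, g y ∂(P (if b then u else m)).toMeasure := by
  rw [← Measure.infinitePi_map_eval (fun b : Bool => (P (if b then u else m)).toMeasure) b,
    integral_map (measurable_pi_apply b).aemeasurable
      (measurable_of_countable g).aestronglyMeasurable]
  rfl

theorem measure_diffBad_le {D₁ : ℝ} (hD : IsUniformEmpiricalConst D₁) (P : Labeler) (k : ℕ)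
    {u m : ℝ} (hum : u ≠ m) {δ : ℝ} (hδ : 0 < δ) (hδ1 : δ < 1) :
    responseLaw P {Y | DiffBad D₁ δ ((1 - (P u none).toReal) - (1 - (P m none).toReal))
      (fun i => Y (k, i, u)) (fun i => Y (k, i, m))} ≤ ENNReal.ofReal δ := by
  set g := (1 - (P u none).toReal) - (1 - (P m none).toReal) with hg
  have hP : ∀ x, 0 ≤ (P x none).toReal ∧ (P x none).toReal ≤ 1 := fun x =>
    ⟨ENNReal.toReal_nonneg, ENNReal.toReal_le_of_le_ofReal zero_le_one
      (by simpa using (P x).coe_le_one none)⟩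
  have hX : IsCenteredIID (Measure.infinitePi fun _ : ℕ => pairLaw P u m)
      (fun i ω => nonAbstain (ω i true) - nonAbstain (ω i false) - g) := by
    refine isCenteredIID_infinitePi _
      (g := fun y : Bool → Response => nonAbstain (y true) - nonAbstain (y false) - g)
      (measurable_of_countable _) (fun y => ?_) ?_
    · have h1 := nonAbstain_mem (y true)
      have h2 := nonAbstain_mem (y false)
      exact ⟨by linarith [h1.1, h2.2, (hP u).1, (hP m).2],
        by linarith [h1.2, h2.1, (hP u).2, (hP m).1]⟩
    · rw [integral_sub (Integrable.of_finite ..) (integrable_const _),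
        integral_sub (Integrable.of_finite ..) (Integrable.of_finite ..),
        integral_pairLaw, integral_pairLaw]
      simp [integral_nonAbstain, hg]
  have key := hD.measure_le hX hδ hδ1
  rw [← map_pair_responseLaw P k hum] at key
  refine ((measure_mono ?_).trans (Measure.le_map_apply
    (Measurable.aemeasurable (by fun_prop)) _)).trans key
  rintro Y ⟨n, hn, hLn, hlt⟩
  refine ⟨n, hn, hLn, ?_⟩
  rw [abstentionDiffs_eq_firstN, sum_firstN] at hlt
  rw [empVar_firstN_sub _ g hn, Finset.sum_sub_distrib]
  simpa using hlt

theorem measure_countBad_le (P : Labeler) (k : ℕ) {u m : ℝ} (hum : u ≠ m) {F : ℝ}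
    (hu : 1 - (P u none).toReal ≤ F) (hm : 1 - (P m none).toReal ≤ F) {δ : ℝ} (hδ : 0 < δ) :
    responseLaw P {Y | CountBad F δ (fun i => Y (k, i, u)) (fun i => Y (k, i, m))} ≤
      ENNReal.ofReal δ := by
  set g : (Bool → Response) → ℝ := fun y => nonAbstain (y true) + nonAbstain (y false) with hg
  have hgm : Measurable g := measurable_of_countable _
  have hg2 : ∀ y, 0 ≤ g y ∧ g y ≤ 2 := fun y => by
    have h1 := nonAbstain_mem (y true)
    have h2 := nonAbstain_mem (y false)
    exact ⟨by simp only [hg]; linarith [h1.1, h2.1], by simp only [hg]; linarith [h1.2, h2.2]⟩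
  have hid : ∀ i : ℕ, IdentDistrib (fun ω : ℕ → Bool → Response => g (ω i))
      (fun ω : ℕ → Bool → Response => g (ω 0))
      (Measure.infinitePi fun _ : ℕ => pairLaw P u m)
      (Measure.infinitePi fun _ : ℕ => pairLaw P u m) := fun i => by
    refine IdentDistrib.comp (f := fun ω : ℕ → Bool → Response => ω i) 
      (g := fun ω : ℕ → Bool → Response => ω 0)
      ⟨(measurable_pi_apply i).aemeasurable, (measurable_pi_apply 0).aemeasurable, ?_⟩ hgm
    rw [Measure.infinitePi_map_eval (fun _ : ℕ => pairLaw P u m) i,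
      Measure.infinitePi_map_eval (fun _ : ℕ => pairLaw P u m) 0]
  have hint : ∫ y, g y ∂pairLaw P u m ≤ 2 * F := by
    simp only [hg]
    rw [integral_add (Integrable.of_finite ..) (Integrable.of_finite ..), integral_pairLaw,
      integral_pairLaw]
    simp only [integral_nonAbstain, if_true, Bool.false_eq_true, if_false]
    linarith
  have hexp : ∀ y, Real.exp (1 / 2 * g y - 2 * F) ≤ Real.exp (-(2 * F)) * (1 + g y) := by
    intro y
    rw [sub_eq_neg_add, Real.exp_add]
    gcongr
    have h1 : |1 / 2 * g y| ≤ 1 := abs_le.2 ⟨by linarith [(hg2 y).1], by linarith [(hg2 y).2]⟩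
    have h2 := (abs_le.1 (Real.abs_exp_sub_one_sub_id_le h1)).2
    nlinarith [(hg2 y).1, (hg2 y).2]
  have h1 : ∫⁻ ω, ENNReal.ofReal (Real.exp (1 / 2 * g (ω 0) - 2 * F))
      ∂(Measure.infinitePi fun _ : ℕ => pairLaw P u m) ≤ 1 := by
    have hmap := Measure.infinitePi_map_eval (fun _ : ℕ => pairLaw P u m) 0
    have hG : Measurable fun y => ENNReal.ofReal (Real.exp (1 / 2 * g y - 2 * F)) := by fun_prop
    have h2 : ∫⁻ ω, ENNReal.ofReal (Real.exp (1 / 2 * g (ω 0) - 2 * F))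
        ∂(Measure.infinitePi fun _ : ℕ => pairLaw P u m) =
        ∫⁻ y, ENNReal.ofReal (Real.exp (1 / 2 * g y - 2 * F)) ∂pairLaw P u m := by
      conv_rhs => rw [← hmap]
      rw [lintegral_map hG (measurable_pi_apply 0)]
    rw [h2]
    calc ∫⁻ y, ENNReal.ofReal (Real.exp (1 / 2 * g y - 2 * F)) ∂pairLaw P u m
        ≤ ∫⁻ y, ENNReal.ofReal (Real.exp (-(2 * F)) * (1 + g y)) ∂pairLaw P u m :=
          lintegral_mono fun y => ENNReal.ofReal_le_ofReal (hexp y)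
      _ = ENNReal.ofReal (∫ y, Real.exp (-(2 * F)) * (1 + g y) ∂pairLaw P u m) := by
          refine (ofReal_integral_eq_lintegral_ofReal (Integrable.of_finite ..)
            (Filter.Eventually.of_forall fun y => ?_)).symm
          exact (Real.exp_pos _).le.trans (hexp y)
      _ ≤ ENNReal.ofReal 1 := by
          refine ENNReal.ofReal_le_ofReal ?_
          rw [integral_const_mul, integral_add (integrable_const _) (Integrable.of_finite ..)]
          simp only [integral_const, probReal_univ, one_smul]
          calc Real.exp (-(2 * F)) * (1 + ∫ y, g y ∂pairLaw P u m)
              ≤ Real.exp (-(2 * F)) * Real.exp (2 * F) := by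
                gcongr
                linarith [Real.add_one_le_exp (2 * F)]
            _ = 1 := by rw [← Real.exp_add]; simp
      _ = 1 := ENNReal.ofReal_one
  have key := measure_exists_le_sum_le (μ := Measure.infinitePi fun _ : ℕ => pairLaw P u m)
    (Z := fun i ω => g (ω i)) (fun i => hgm.comp (measurable_pi_apply i))
    (iIndepFun_infinitePi (X := fun _ => g) fun _ => hgm) hid h1 (Real.log (1 / δ))
  rw [← Real.log_inv, one_div, inv_inv, Real.exp_log hδ, ← map_pair_responseLaw P k hum] at key
  refine ((measure_mono ?_).trans (Measure.le_map_apply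
    (Measurable.aemeasurable (by fun_prop)) _)).trans key
  rintro Y ⟨n, hn⟩
  refine ⟨n, ?_⟩
  simp only [hg, if_true, Bool.false_eq_true, if_false]
  rw [one_div] at hn
  linarith

theorem measure_ne_none_ne_zero {p : PMF Response} (h : (p none).toReal < 1) :
    p.toMeasure {y | y ≠ none} ≠ 0 := by
  intro h0
  have h1 := prob_add_prob_compl (μ := p.toMeasure) (measurableSet_singleton (none : Response))
  rw [show ({none}ᶜ : Set Response) = {y | y ≠ none} from rfl, h0, add_zero,
    PMF.toMeasure_apply_singleton _ _ (measurableSet_singleton _)] at h1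
  rw [h1] at h
  simp at h

theorem measure_labelBad_le {D₀ : ℝ} (hD : IsUniformConst D₀) (P : Labeler) (k : ℕ) {u : ℝ}
    (h : (P u).toMeasure {y | y ≠ none} ≠ 0) {s : ℝ} (hs : |s| = 1)
    (hmean : ∫ b, s * signOf b ∂labelLaw (P u).toMeasure ≤ 0) {δ : ℝ} (hδ : 0 < δ)
    (hδ1 : δ < 1) :
    responseLaw P {Y | LabelBad D₀ δ s (fun i => Y (k, i, u))} ≤ ENNReal.ofReal δ := by
  have key := hD.measure_labelArray_le h hs hmean hδ hδ1
  rw [← map_single_responseLaw P k u] at key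
  refine ((measure_mono ?_).trans (Measure.le_map_apply
    (Measurable.aemeasurable (by fun_prop)) _)).trans key
  exact fun Y hY => hY

end PairLaw

theorem integral_signOf_le_of_lt {P : Labeler} {θ u : ℝ} (hP : MonotoneAbstention P θ)
    (hu : u ∈ Icc (0 : ℝ) 1) (hθ : θ < u) (h : (P u).toMeasure {y | y ≠ none} ≠ 0) :
    ∫ b, (-1) * signOf b ∂labelLaw (P u).toMeasure ≤ 0 := by
  have h1 := hP.noise u hu
  have h2 : trueLabel θ u = some true := by simp [trueLabel, hθ]
  rw [integral_signOf_labelLaw h]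
  have h3 : labelLaw (P u).toMeasure {false} ≤ 1 / 2 := by
    rw [labelLaw_apply]
    refine (measure_mono fun y hy => ?_).trans h1
    rw [h2]
    rintro rfl
    simp at hy
  have h4 : (labelLaw (P u).toMeasure).real {false} ≤ 1 / 2 := by
    have := ENNReal.toReal_mono (by simp) h3
    simpa [measureReal_def] using this
  linarith

theorem integral_signOf_le_of_gt {P : Labeler} {θ u : ℝ} (hP : MonotoneAbstention P θ)
    (hu : u ∈ Icc (0 : ℝ) 1) (hθ : u < θ) (h : (P u).toMeasure {y | y ≠ none} ≠ 0) :
    ∫ b, 1 * signOf b ∂labelLaw (P u).toMeasure ≤ 0 := by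
  have := isProbabilityMeasure_labelLaw h
  have h1 := hP.noise u hu
  have h2 : trueLabel θ u = some false := by simp [trueLabel, hθ.le]
  rw [integral_signOf_labelLaw h]
  have h3 : labelLaw (P u).toMeasure {false}ᶜ ≤ 1 / 2 := by
    rw [labelLaw_apply]
    refine (measure_mono fun y hy => ?_).trans h1
    rw [h2]
    rintro rfl
    simp at hy
  have h4 : (labelLaw (P u).toMeasure).real {false}ᶜ ≤ 1 / 2 := by
    have := ENNReal.toReal_mono (by simp) h3
    simpa [measureReal_def] using this
  rw [probReal_compl_eq_one_sub (measurableSet_singleton _)] at h4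
  linarith

/-! ### Outcome of a round outside the failure events -/

/-- If the mean `g` of the differences is negative, the variance test does not succeed. -/
theorem not_checkSignificantVar {D₁ δ g : ℝ} {y z : ℕ → Response} (h : ¬DiffBad D₁ δ g y z)
    (hg : g < 0) {n : ℕ} (hn : 0 < n) : ¬CheckSignificantVar D₁ (abstentionDiffs y z n) δ := by
  rintro ⟨h1, h2⟩
  rw [abstentionDiffs_eq_firstN, length_firstN] at h1
  have h3 : |(abstentionDiffs y z n).sum - n * g| ≤
      qThreshold D₁ (empVar (abstentionDiffs y z n)) δ := by
    by_contra hcon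
    exact h ⟨n, hn, h1, not_le.1 hcon⟩
  have h4 := (abs_le.1 h3).2
  have h5 : (n : ℝ) * g < 0 := mul_neg_of_pos_of_neg (by exact_mod_cast hn) hg
  linarith

theorem empVar_abstentionDiffs_le {F δ : ℝ} {y z : ℕ → Response} (h : ¬CountBad F δ y z) {n : ℕ}
    (hn : 2 ≤ n) : empVar (abstentionDiffs y z n) ≤ 8 * n * F + 4 * Real.log (1 / δ) := by
  have hn2 : (2 : ℝ) ≤ n := by exact_mod_cast hn
  have h1 : ∑ i ∈ Finset.range n, (nonAbstain (y i) + nonAbstain (z i)) ≤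
      4 * n * F + 2 * Real.log (1 / δ) := by
    by_contra hcon
    exact h ⟨n, (not_le.1 hcon).le⟩
  rw [abstentionDiffs_eq_firstN, empVar_firstN]
  have h2 : ∑ i ∈ Finset.range n, (nonAbstain (y i) - nonAbstain (z i)) ^ 2 ≤
      ∑ i ∈ Finset.range n, (nonAbstain (y i) + nonAbstain (z i)) := by
    refine Finset.sum_le_sum fun i _ => ?_
    have h3 := nonAbstain_mem (y i)
    have h4 := nonAbstain_mem (z i)
    nlinarith [h3.1, h3.2, h4.1, h4.2]
  have h3 : (0 : ℝ) ≤ ∑ i ∈ Finset.range n, (nonAbstain (y i) - nonAbstain (z i)) ^ 2 :=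
    Finset.sum_nonneg fun i _ => sq_nonneg _
  have h4 : (n : ℝ) / (n - 1) ≤ 2 := by
    rw [div_le_iff₀ (by linarith)]
    linarith
  have h5 : 0 ≤ (n : ℝ) / (n - 1) := div_nonneg (by linarith) (by linarith)
  calc (n : ℝ) / (n - 1) * (∑ i ∈ Finset.range n, (nonAbstain (y i) - nonAbstain (z i)) ^ 2 -
        (∑ i ∈ Finset.range n, (nonAbstain (y i) - nonAbstain (z i))) ^ 2 / n)
      ≤ (n : ℝ) / (n - 1) * ∑ i ∈ Finset.range n, (nonAbstain (y i) - nonAbstain (z i)) ^ 2 := by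
        gcongr
        have : 0 ≤ (∑ i ∈ Finset.range n, (nonAbstain (y i) - nonAbstain (z i))) ^ 2 / n := by
          positivity
        linarith
    _ ≤ 2 * ∑ i ∈ Finset.range n, (nonAbstain (y i) - nonAbstain (z i)) ^ 2 := by gcongr
    _ ≤ _ := by linarith

/-- If the mean `g` of the differences is a fixed fraction of the answer rate `F`, the variance test
succeeds as soon as `n F` is large in the sense of the hypothesis `hN`. -/
theorem checkSignificantVar_of_gap {D₁ δ g F c : ℝ} {y z : ℕ → Response}
    (h : ¬DiffBad D₁ δ g y z) (h' : ¬CountBad F δ y z) (hg : c * F ≤ g) {n : ℕ} (hn : 2 ≤ n)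
    (hδ : 0 < δ) (hδ1 : δ ≤ 1) (hLn : Real.log (1 / δ) ≤ n)
    (hN : 2 * (|D₁| * devBound (8 * (n * F) + 5 * Real.log (1 / δ) + 1) (Real.log (1 / δ))) ≤
      c * (n * F)) :
    CheckSignificantVar D₁ (abstentionDiffs y z n) δ := by
  have hn0 : 0 < n := by omega
  have hL := log_inv_nonneg hδ hδ1
  have h3 : |(abstentionDiffs y z n).sum - n * g| ≤
      qThreshold D₁ (empVar (abstentionDiffs y z n)) δ := by
    by_contra hcon
    exact h ⟨n, hn0, hLn, not_le.1 hcon⟩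
  have hV := empVar_abstentionDiffs_le h' hn
  have hV0 : 0 ≤ empVar (abstentionDiffs y z n) := by
    rw [abstentionDiffs_eq_firstN]
    exact empVar_firstN_nonneg _ hn0
  have hq : qThreshold D₁ (empVar (abstentionDiffs y z n)) δ ≤
      |D₁| * devBound (8 * (n * F) + 5 * Real.log (1 / δ) + 1) (Real.log (1 / δ)) := by
    rw [qThreshold_eq]
    have hb := one_le_devBound
      (x := empVar (abstentionDiffs y z n) + Real.log (1 / δ) + 1) hL
    refine (mul_le_mul_of_nonneg_right (le_abs_self D₁) (by linarith)).trans ?_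
    gcongr
    exact devBound_mono (by linarith) (by linarith) hL le_rfl
  have h4 := (abs_le.1 h3).1
  have h5 : (n : ℝ) * (c * F) ≤ n * g := by gcongr
  refine ⟨?_, ?_⟩
  · rwa [abstentionDiffs_eq_firstN, length_firstN]
  · linarith

/-- The failure event of a round, in terms of the responses `y i x` of that round. The event
`CountBad` concerns the quartile that is farther from `θ`; labels can mislead only at a quartile
that separates `θ` from the middle of the interval. -/
def RoundBad (D₀ D₁ δ θ : ℝ) (a : ℝ → ℝ) (l r : ℝ) (y : ℕ → ℝ → Response) : Prop :=
  DiffBad D₁ δ (a ((3 * l + r) / 4) - a ((l + r) / 2)) (fun i => y i ((3 * l + r) / 4))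
      (fun i => y i ((l + r) / 2)) ∨
  DiffBad D₁ δ (a ((l + 3 * r) / 4) - a ((l + r) / 2)) (fun i => y i ((l + 3 * r) / 4))
      (fun i => y i ((l + r) / 2)) ∨
  (θ < (3 * l + r) / 4 ∧ LabelBad D₀ δ (-1) (fun i => y i ((3 * l + r) / 4)) ∨
    (l + 3 * r) / 4 < θ ∧ LabelBad D₀ δ 1 (fun i => y i ((l + 3 * r) / 4))) ∨
  (θ ≤ (l + r) / 2 ∧ CountBad (a ((l + 3 * r) / 4)) δ (fun i => y i ((l + 3 * r) / 4))
      (fun i => y i ((l + r) / 2)) ∨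
    (l + r) / 2 < θ ∧ CountBad (a ((3 * l + r) / 4)) δ (fun i => y i ((3 * l + r) / 4))
      (fun i => y i ((l + r) / 2)))

theorem sum_map_neg (B : List ℝ) : (B.map fun b => -b).sum = -1 * B.sum := by
  induction B with
  | nil => simp
  | cons b B ih => rw [List.map_cons, List.sum_cons, List.sum_cons, ih]; ring

theorem oneRound_of_tests {D₀ D₁ δ : ℝ} {useLabels : Bool} {s : State} {θ : ℝ}
    {y : ℕ → ℝ → Response} {N : ℕ} (hN : 1 ≤ N)
    (htest : (tests D₀ D₁ δ useLabels s.left s.right y N).isSome = true)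
    (hsound : ∀ n, 1 ≤ n → ∀ I, tests D₀ D₁ δ useLabels s.left s.right y n = some I →
      I = ((3 * s.left + s.right) / 4, s.right) ∧ (3 * s.left + s.right) / 4 ≤ θ ∨
      I = (s.left, (s.left + 3 * s.right) / 4) ∧ θ ≤ (s.left + 3 * s.right) / 4) :
    ∃ s', oneRound D₀ D₁ δ useLabels y s = some s' ∧ s'.queries ≤ s.queries + 3 * N ∧
      (s'.left = (3 * s.left + s.right) / 4 ∧ s'.right = s.right ∧
          (3 * s.left + s.right) / 4 ≤ θ ∨
        s'.left = s.left ∧ s'.right = (s.left + 3 * s.right) / 4 ∧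
          θ ≤ (s.left + 3 * s.right) / 4) := by
  classical
  have hex : ∃ n : ℕ, 1 ≤ n ∧ (tests D₀ D₁ δ useLabels s.left s.right y n).isSome = true :=
    ⟨N, hN, htest⟩
  rw [oneRound, dif_pos hex]
  obtain ⟨hn1, hn⟩ := Nat.find_spec hex
  have hle : Nat.find hex ≤ N := Nat.find_min' hex ⟨hN, htest⟩
  obtain ⟨I, hI⟩ := Option.isSome_iff_exists.1 hn
  refine ⟨_, by rw [hI]; rfl, by dsimp only; omega, ?_⟩
  rcases hsound _ hn1 I hI with ⟨rfl, h⟩ | ⟨rfl, h⟩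
  · exact Or.inl ⟨rfl, rfl, h⟩
  · exact Or.inr ⟨rfl, rfl, h⟩

/-- Outside the failure event, a round ends within `N` triples of queries and keeps `θ` in the
interval. The flatness condition enters twice: it makes the mean of the differences negative on the
wrong side of `θ`, and at least `c` times the answer rate at the farther quartile. -/
theorem exists_oneRound_eq {D₀ D₁ δ θ c : ℝ} {f a : ℝ → ℝ} (hf : NotTooFlat c f) (hc : 0 < c)
    (ha : ∀ x ∈ Icc (0 : ℝ) 1, a x = f |x - θ|) (hδ : 0 < δ) (hδ1 : δ ≤ 1) {s : State}
    (h0 : 0 ≤ s.left) (h1 : s.right ≤ 1) (hlr : s.left < s.right) (hθl : s.left ≤ θ)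
    (hθr : θ ≤ s.right) {N : ℕ} (hN2 : 2 ≤ N) (hLN : Real.log (1 / δ) ≤ N) {F₀ : ℝ}
    (hF₀ : ∀ b, (s.right - s.left) / 4 ≤ b → b ≤ 1 → F₀ ≤ f b)
    (hN : ∀ F, F₀ ≤ F → F ≤ 1 →
      2 * (|D₁| * devBound (8 * (N * F) + 5 * Real.log (1 / δ) + 1) (Real.log (1 / δ))) ≤
        c * (N * F))
    (useLabels : Bool) {y : ℕ → ℝ → Response}
    (hy : ¬RoundBad D₀ D₁ δ θ a s.left s.right y) :
    ∃ s', oneRound D₀ D₁ δ useLabels y s = some s' ∧ s'.queries ≤ s.queries + 3 * N ∧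
      s'.right - s'.left = 3 / 4 * (s.right - s.left) ∧ s'.left ≤ θ ∧ θ ≤ s'.right ∧
      0 ≤ s'.left ∧ s'.right ≤ 1 := by
  obtain ⟨k, l, r⟩ := s
  simp only at *
  set U := (3 * l + r) / 4 with hU
  set M := (l + r) / 2 with hM
  set V := (l + 3 * r) / 4 with hV
  have hU01 : U ∈ Icc (0 : ℝ) 1 := ⟨by linarith, by linarith⟩
  have hM01 : M ∈ Icc (0 : ℝ) 1 := ⟨by linarith, by linarith⟩
  have hV01 : V ∈ Icc (0 : ℝ) 1 := ⟨by linarith, by linarith⟩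
  simp only [RoundBad, ← hU, ← hM, ← hV, not_or, not_and] at hy
  obtain ⟨hdU, hdV, ⟨hlU, hlV⟩, hcV, hcU⟩ := hy
  have hratio : ∀ b d, 0 ≤ b → 0 < d → d ≤ 1 → b ≤ 2 / 3 * d → f b ≤ (1 - c) * f d :=
    fun b d hb hd hd1 hbd => by
      have := hf.ratio d hd hd1 b hb hbd
      rwa [div_le_iff₀ (hf.pos d hd hd1)] at this
  -- a wrong test of the abstentions would have a negative mean
  have hgU : θ < U → a U - a M < 0 := fun hθ => by
    rw [ha U hU01, ha M hM01, abs_of_pos (by linarith), abs_of_pos (by linarith)]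
    have h3 := hf.pos (M - θ) (by linarith) (by linarith)
    have h4 := hratio (U - θ) (M - θ) (by linarith) (by linarith) (by linarith) (by linarith)
    nlinarith
  have hgV : V < θ → a V - a M < 0 := fun hθ => by
    rw [ha V hV01, ha M hM01, abs_of_neg (by linarith), abs_of_neg (by linarith)]
    have h3 := hf.pos (-(M - θ)) (by linarith) (by linarith)
    have h4 := hratio (-(V - θ)) (-(M - θ)) (by linarith) (by linarith) (by linarith)
      (by linarith)
    nlinarith
  have htest : (tests D₀ D₁ δ useLabels l r y N).isSome = true := by
    have hsig : CheckSignificantVar D₁ (abstentionDiffs (fun i => y i U) (fun i => y i M) N) δ ∨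
        CheckSignificantVar D₁ (abstentionDiffs (fun i => y i V) (fun i => y i M) N) δ := by
      rcases le_or_gt θ M with hθM | hθM
      · right
        have habs : |V - θ| = V - θ := abs_of_pos (by linarith)
        have habs' : |M - θ| = M - θ := abs_of_nonneg (by linarith)
        have h4 := hratio (M - θ) (V - θ) (by linarith) (by linarith) (by linarith) (by linarith)
        have hFle : a V ≤ 1 := by
          rw [ha V hV01, habs]
          exact (hf.mapsTo ⟨by linarith, by linarith⟩).2
        refine checkSignificantVar_of_gap hdV (hcV hθM) (c := c) ?_ hN2 hδ hδ1 hLN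
          (hN _ ?_ hFle)
        · rw [ha V hV01, ha M hM01, habs, habs']
          linarith
        · rw [ha V hV01, habs]
          exact hF₀ _ (by linarith) (by linarith)
      · left
        have habs : |U - θ| = θ - U := by rw [abs_of_neg (by linarith)]; ring
        have habs' : |M - θ| = θ - M := by rw [abs_of_neg (by linarith)]; ring
        have h4 := hratio (θ - M) (θ - U) (by linarith) (by linarith) (by linarith) (by linarith)
        have hFle : a U ≤ 1 := by
          rw [ha U hU01, habs]
          exact (hf.mapsTo ⟨by linarith, by linarith⟩).2
        refine checkSignificantVar_of_gap hdU (hcU hθM) (c := c) ?_ hN2 hδ hδ1 hLN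
          (hN _ ?_ hFle)
        · rw [ha U hU01, ha M hM01, habs, habs']
          linarith
        · rw [ha U hU01, habs]
          exact hF₀ _ (by linarith) (by linarith)
    unfold tests
    simp only [← hU, ← hM, ← hV]
    split_ifs <;> first | rfl | tauto
  have hsound : ∀ n, 1 ≤ n → ∀ I, tests D₀ D₁ δ useLabels l r y n = some I →
      I = (U, r) ∧ U ≤ θ ∨ I = (l, V) ∧ θ ≤ V := by
    intro n hn I hI
    unfold tests at hI
    simp only [← hU, ← hM, ← hV] at hI
    split_ifs at hI with t1 t2 t3 t4
    · refine Or.inl ⟨(Option.some.inj hI).symm, not_lt.1 fun hθ => ?_⟩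
      exact not_checkSignificantVar hdU (hgU hθ) hn t1
    · refine Or.inr ⟨(Option.some.inj hI).symm, not_lt.1 fun hθ => ?_⟩
      exact not_checkSignificantVar hdV (hgV hθ) hn t2
    · refine Or.inl ⟨(Option.some.inj hI).symm, not_lt.1 fun hθ => hlU hθ ⟨n, ?_⟩⟩
      have := t3.2
      rwa [CheckSignificant, List.length_map, sum_map_neg] at this
    · refine Or.inr ⟨(Option.some.inj hI).symm, not_lt.1 fun hθ => hlV hθ ⟨n, ?_⟩⟩
      rw [one_mul]
      exact t4.2
  obtain ⟨s', hs', hq, hcase⟩ := oneRound_of_tests (s := ⟨k, l, r⟩) (by omega) htest hsound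
  refine ⟨s', hs', hq, ?_⟩
  simp only [← hU, ← hV] at hcase
  rcases hcase with ⟨hl, hr, hθ⟩ | ⟨hl, hr, hθ⟩ <;> rw [hl, hr]
  · exact ⟨by linarith, hθ, hθr, by linarith, h1⟩
  · exact ⟨by linarith, hθl, hθ, h0, by linarith⟩

/-- The failure probability of a round is at most `4 δ`. -/
theorem measure_roundBad_le {D₀ D₁ : ℝ} (hD₀ : IsUniformConst D₀)
    (hD₁ : IsUniformEmpiricalConst D₁) {P : Labeler} {θ c : ℝ} {f : ℝ → ℝ}
    (hf : NotTooFlat c f) (hP : MonotoneAbstention P θ) (hPf : AbstentionRate P f θ) (k : ℕ)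
    {l r : ℝ} (h0 : 0 ≤ l) (h1 : r ≤ 1) (hlr : l < r) (hθl : l ≤ θ) (hθr : θ ≤ r) {δ : ℝ}
    (hδ : 0 < δ) (hδ1 : δ < 1) :
    responseLaw P {Y | RoundBad D₀ D₁ δ θ (fun x => 1 - (P x none).toReal) l r
      (fun i x => Y (k, i, x))} ≤ ENNReal.ofReal (4 * δ) := by
  have ha : ∀ x ∈ Icc (0 : ℝ) 1, 1 - (P x none).toReal = f |x - θ| := fun x hx => by
    rw [hPf x hx]; ring
  set U := (3 * l + r) / 4 with hU
  set M := (l + r) / 2 with hM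
  set V := (l + 3 * r) / 4 with hV
  have hU01 : U ∈ Icc (0 : ℝ) 1 := ⟨by linarith, by linarith⟩
  have hM01 : M ∈ Icc (0 : ℝ) 1 := ⟨by linarith, by linarith⟩
  have hV01 : V ∈ Icc (0 : ℝ) 1 := ⟨by linarith, by linarith⟩
  have hmono : ∀ x ∈ Icc (0 : ℝ) 1, ∀ z ∈ Icc (0 : ℝ) 1, |x - θ| ≤ |z - θ| →
      1 - (P x none).toReal ≤ 1 - (P z none).toReal := fun x hx z hz h => by
    rw [ha x hx, ha z hz]
    have hz1 : |z - θ| ≤ 1 := abs_le.2 ⟨by linarith [hz.1], by linarith [hz.2]⟩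
    exact hf.monotone ⟨abs_nonneg _, h.trans hz1⟩ ⟨abs_nonneg _, hz1⟩ h
  have hne : ∀ x ∈ Icc (0 : ℝ) 1, x ≠ θ → (P x).toMeasure {y | y ≠ none} ≠ 0 := fun x hx hxθ => by
    refine measure_ne_none_ne_zero ?_
    have h2 := hf.pos |x - θ| (abs_pos.2 (sub_ne_zero.2 hxθ))
      (abs_le.2 ⟨by linarith [hx.1], by linarith [hx.2]⟩)
    linarith [ha x hx]
  have e1 := measure_diffBad_le hD₁ P k (u := U) (m := M) (by linarith [hU, hM] : U < M).ne hδ hδ1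
  have e2 := measure_diffBad_le hD₁ P k (u := V) (m := M) (by linarith [hV, hM] : M < V).ne' hδ hδ1
  have e3 : responseLaw P {Y | θ < U ∧ LabelBad D₀ δ (-1) (fun i => Y (k, i, U)) ∨
      V < θ ∧ LabelBad D₀ δ 1 (fun i => Y (k, i, V))} ≤ ENNReal.ofReal δ := by
    rcases lt_or_ge θ U with hθ | hθ
    · refine (measure_mono fun Y hY => ?_).trans (measure_labelBad_le hD₀ P k (hne U hU01 hθ.ne')
        (by simp) (integral_signOf_le_of_lt hP hU01 hθ (hne U hU01 hθ.ne')) hδ hδ1)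
      rcases hY with ⟨_, h⟩ | ⟨h, _⟩
      · exact h
      · exact absurd h (by linarith)
    · rcases lt_or_ge V θ with hθ' | hθ'
      · refine (measure_mono fun Y hY => ?_).trans (measure_labelBad_le hD₀ P k
          (hne V hV01 hθ'.ne) (by simp)
          (integral_signOf_le_of_gt hP hV01 hθ' (hne V hV01 hθ'.ne)) hδ hδ1)
        rcases hY with ⟨h, _⟩ | ⟨_, h⟩
        · exact absurd h (by linarith)
        · exact h
      · refine (measure_mono (t := ∅) fun Y hY => ?_).trans (by simp)
        rcases hY with ⟨h, _⟩ | ⟨h, _⟩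
        · exact absurd h (by linarith)
        · exact absurd h (by linarith)
  have e4 : responseLaw P {Y |
      θ ≤ M ∧ CountBad (1 - (P V none).toReal) δ (fun i => Y (k, i, V)) (fun i => Y (k, i, M)) ∨
      M < θ ∧ CountBad (1 - (P U none).toReal) δ (fun i => Y (k, i, U))
        (fun i => Y (k, i, M))} ≤ ENNReal.ofReal δ := by
    rcases le_or_gt θ M with hθ | hθ
    · refine (measure_mono fun Y hY => ?_).trans (measure_countBad_le P k
        (u := V) (m := M) (by linarith [hV, hM] : M < V).ne' le_rfl (hmono M hM01 V hV01 ?_) hδ)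
      · rcases hY with ⟨_, h⟩ | ⟨h, _⟩
        · exact h
        · exact absurd h (by linarith)
      · rw [abs_of_nonneg (by linarith), abs_of_nonneg (by linarith)]
        linarith
    · refine (measure_mono fun Y hY => ?_).trans (measure_countBad_le P k
        (u := U) (m := M) (by linarith [hU, hM] : U < M).ne le_rfl (hmono M hM01 U hU01 ?_) hδ)
      · rcases hY with ⟨h, _⟩ | ⟨_, h⟩
        · exact absurd h (by linarith)
        · exact h
      · rw [abs_of_neg (by linarith), abs_of_neg (by linarith)]
        linarith
  refine ((measure_union_le _ _).trans (add_le_add e1 ((measure_union_le _ _).trans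
    (add_le_add e2 ((measure_union_le _ _).trans (add_le_add e3 e4)))))).trans_eq ?_
  rw [← ENNReal.ofReal_add hδ.le hδ.le, ← ENNReal.ofReal_add hδ.le (by linarith),
    ← ENNReal.ofReal_add hδ.le (by linarith)]
  congr 1
  ring

/-! ### Adaptivity: the state before a round is independent of the responses in it -/

/-- The labels of the queries of round `k`. -/
def roundQueries (k : ℕ) : Set (ℕ × ℕ × ℝ) := {q | q.1 = k}

/-- The labels of the queries of the rounds before round `k`. -/
def pastQueries (k : ℕ) : Set (ℕ × ℕ × ℝ) := {q | q.1 < k}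

theorem measurableSet_round (k : ℕ) (E : Finset ℝ) {Q : ℕ → (ℕ → ℝ → Response) → Prop}
    (hQ : ∀ n y y', (∀ i < n, ∀ x ∈ E, y i x = y' i x) → Q n y → Q n y') :
    MeasurableSet[coordAlgebra Response (roundQueries k)]
      {Y | ∃ n, Q n (fun i x => Y (k, i, x))} := by
  have hset : {Y : ℕ × ℕ × ℝ → Response | ∃ n, Q n (fun i x => Y (k, i, x))} =
      ⋃ n, {Y | Q n (fun i x => Y (k, i, x))} := by
    ext Y
    simp
  rw [hset]
  refine MeasurableSet.iUnion fun n => ?_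
  refine measurableSet_coordAlgebra ({k} ×ˢ Finset.range n ×ˢ E) ?_ ?_
  · rintro ⟨k', i, x⟩ hq
    simp only [Finset.coe_product, mem_prod, Finset.mem_coe, Finset.mem_singleton] at hq
    exact hq.1
  · intro Y Y' h
    exact hQ n _ _ fun i hi x hx => h _ (by simp [hi, hx])

theorem measurableSet_roundBad (k : ℕ) (D₀ D₁ δ θ : ℝ) (a : ℝ → ℝ) (l r : ℝ) :
    MeasurableSet[coordAlgebra Response (roundQueries k)]
      {Y | RoundBad D₀ D₁ δ θ a l r (fun i x => Y (k, i, x))} := by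
  have hdiff : ∀ g u m, MeasurableSet[coordAlgebra Response (roundQueries k)]
      {Y : ℕ × ℕ × ℝ → Response | DiffBad D₁ δ g (fun i => Y (k, i, u)) (fun i => Y (k, i, m))} :=
    fun g u m => measurableSet_round k {u, m} (Q := fun n y => 0 < n ∧ Real.log (1 / δ) ≤ n ∧
      qThreshold D₁ (empVar (abstentionDiffs (fun i => y i u) (fun i => y i m) n)) δ <
        |(abstentionDiffs (fun i => y i u) (fun i => y i m) n).sum - n * g|)
      fun n y y' h hy => by
        rwa [abstentionDiffs_congr (fun i hi => h i hi u (by simp))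
          (fun i hi => h i hi m (by simp))] at hy
  have hcount : ∀ F u m, MeasurableSet[coordAlgebra Response (roundQueries k)]
      {Y : ℕ × ℕ × ℝ → Response | CountBad F δ (fun i => Y (k, i, u)) (fun i => Y (k, i, m))} :=
    fun F u m => measurableSet_round k {u, m} (Q := fun n y => 4 * n * F + 2 * Real.log (1 / δ) ≤
      ∑ i ∈ Finset.range n, (nonAbstain (y i u) + nonAbstain (y i m)))
      fun n y y' h hy => by
        refine hy.trans_eq (Finset.sum_congr rfl fun i hi => ?_)
        rw [h i (Finset.mem_range.1 hi) u (by simp), h i (Finset.mem_range.1 hi) m (by simp)]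
  have hlabel : ∀ s u, MeasurableSet[coordAlgebra Response (roundQueries k)]
      {Y : ℕ × ℕ × ℝ → Response | LabelBad D₀ δ s (fun i => Y (k, i, u))} :=
    fun s u => measurableSet_round k {u} (Q := fun n y =>
      pThreshold D₀ (labelArray (fun i => y i u) n).length δ ≤
        s * (labelArray (fun i => y i u) n).sum)
      fun n y y' h hy => by
        rwa [labelArray_congr (fun i hi => h i hi u (by simp))] at hy
  have hconst : ∀ p : Prop, MeasurableSet[coordAlgebra Response (roundQueries k)]
      {_Y : ℕ × ℕ × ℝ → Response | p} := fun p => @MeasurableSet.const _ (coordAlgebra _ _) p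
  exact (hdiff _ _ _).union ((hdiff _ _ _).union
    ((((hconst _).inter (hlabel _ _)).union ((hconst _).inter (hlabel _ _))).union
      (((hconst _).inter (hcount _ _ _)).union ((hconst _).inter (hcount _ _ _)))))

theorem tests_congr {D₀ D₁ δ : ℝ} {useLabels : Bool} {l r : ℝ} {y y' : ℕ → ℝ → Response} {n : ℕ}
    (h : ∀ i < n, ∀ x ∈ ({(3 * l + r) / 4, (l + r) / 2, (l + 3 * r) / 4} : Finset ℝ),
      y i x = y' i x) :
    tests D₀ D₁ δ useLabels l r y n = tests D₀ D₁ δ useLabels l r y' n := by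
  have hU : ∀ i < n, y i ((3 * l + r) / 4) = y' i ((3 * l + r) / 4) := fun i hi =>
    h i hi _ (by simp)
  have hM : ∀ i < n, y i ((l + r) / 2) = y' i ((l + r) / 2) := fun i hi => h i hi _ (by simp)
  have hV : ∀ i < n, y i ((l + 3 * r) / 4) = y' i ((l + 3 * r) / 4) := fun i hi =>
    h i hi _ (by simp)
  have e1 : abstentionDiffs (fun i => y i ((3 * l + r) / 4)) (fun i => y i ((l + r) / 2)) n =
      abstentionDiffs (fun i => y' i ((3 * l + r) / 4)) (fun i => y' i ((l + r) / 2)) n :=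
    abstentionDiffs_congr hU hM
  have e2 : abstentionDiffs (fun i => y i ((l + 3 * r) / 4)) (fun i => y i ((l + r) / 2)) n =
      abstentionDiffs (fun i => y' i ((l + 3 * r) / 4)) (fun i => y' i ((l + r) / 2)) n :=
    abstentionDiffs_congr hV hM
  have e3 : labelArray (fun i => y i ((3 * l + r) / 4)) n =
      labelArray (fun i => y' i ((3 * l + r) / 4)) n := labelArray_congr hU
  have e4 : labelArray (fun i => y i ((l + 3 * r) / 4)) n =
      labelArray (fun i => y' i ((l + 3 * r) / 4)) n := labelArray_congr hV
  unfold tests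
  simp only
  rw [e1, e2, e3, e4]

theorem tests_eq_some {D₀ D₁ δ : ℝ} {useLabels : Bool} {l r : ℝ} {y : ℕ → ℝ → Response} {n : ℕ}
    {I : ℝ × ℝ} (h : tests D₀ D₁ δ useLabels l r y n = some I) :
    I = ((3 * l + r) / 4, r) ∨ I = (l, (l + 3 * r) / 4) := by
  unfold tests at h
  simp only at h
  split_ifs at h
  · exact Or.inl (Option.some.inj h).symm
  · exact Or.inr (Option.some.inj h).symm
  · exact Or.inl (Option.some.inj h).symm
  · exact Or.inr (Option.some.inj h).symm

theorem oneRound_eq_some_iff {D₀ D₁ δ : ℝ} {useLabels : Bool} {y : ℕ → ℝ → Response}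
    {s s' : State} : oneRound D₀ D₁ δ useLabels y s = some s' ↔
      ∃ n, 1 ≤ n ∧ (∀ m < n, 1 ≤ m → tests D₀ D₁ δ useLabels s.left s.right y m = none) ∧
        ∃ I, tests D₀ D₁ δ useLabels s.left s.right y n = some I ∧
          s' = { queries := s.queries + 3 * n, left := I.1, right := I.2 } := by
  classical
  constructor
  · intro h
    unfold oneRound at h
    split_ifs at h with hex
    obtain ⟨I, hI, hs'⟩ := Option.map_eq_some_iff.1 h
    refine ⟨Nat.find hex, (Nat.find_spec hex).1, fun m hm hm1 => ?_, I, hI, hs'.symm⟩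
    have := Nat.find_min hex hm
    simpa [hm1] using this
  · rintro ⟨n, hn1, hmin, I, hI, rfl⟩
    have hex : ∃ n : ℕ, 1 ≤ n ∧ (tests D₀ D₁ δ useLabels s.left s.right y n).isSome = true :=
      ⟨n, hn1, by simp [hI]⟩
    have hfind : Nat.find hex = n := by
      rw [Nat.find_eq_iff]
      refine ⟨⟨hn1, by simp [hI]⟩, fun m hm hm' => ?_⟩
      rw [hmin m hm hm'.1] at hm'
      simp at hm'
    rw [oneRound, dif_pos hex, hfind, hI]
    rfl

theorem measurableSet_oneRound (D₀ D₁ δ : ℝ) (useLabels : Bool) (k : ℕ) (s s' : State) :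
    MeasurableSet[coordAlgebra Response (roundQueries k)]
      {Y | oneRound D₀ D₁ δ useLabels (fun i x => Y (k, i, x)) s = some s'} := by
  simp only [oneRound_eq_some_iff]
  refine measurableSet_round k {(3 * s.left + s.right) / 4, (s.left + s.right) / 2,
    (s.left + 3 * s.right) / 4} (Q := fun n y => 1 ≤ n ∧
      (∀ m < n, 1 ≤ m → tests D₀ D₁ δ useLabels s.left s.right y m = none) ∧
        ∃ I, tests D₀ D₁ δ useLabels s.left s.right y n = some I ∧
          s' = { queries := s.queries + 3 * n, left := I.1, right := I.2 }) ?_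
  rintro n y y' h ⟨hn, hm, hI⟩
  refine ⟨hn, fun m hmn hm1 => ?_, ?_⟩
  · rw [← tests_congr fun i hi x hx => h i (hi.trans hmn) x hx]
    exact hm m hmn hm1
  · rwa [← tests_congr h]

theorem countable_run (D₀ D₁ δ : ℝ) (useLabels : Bool) (k : ℕ) :
    {s | ∃ Y, run D₀ D₁ δ useLabels Y k = some s}.Countable := by
  induction k with
  | zero =>
    refine (countable_singleton ({ queries := 0, left := 0, right := 1 } : State)).mono ?_
    rintro s ⟨Y, hY⟩
    exact (Option.some.inj hY).symm
  | succ k ih =>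
    refine (ih.biUnion (t := fun s _ => ⋃ n : ℕ,
      {({ queries := s.queries + 3 * n, left := (3 * s.left + s.right) / 4,
          right := s.right } : State),
        { queries := s.queries + 3 * n, left := s.left,
          right := (s.left + 3 * s.right) / 4 }}) fun s _ =>
      countable_iUnion fun n => (toFinite _).countable).mono ?_
    rintro s' ⟨Y, hY⟩
    obtain ⟨s, hs, hs'⟩ := Option.bind_eq_some_iff.1 hY
    obtain ⟨n, -, -, I, hI, rfl⟩ := oneRound_eq_some_iff.1 hs'
    refine mem_biUnion (x := s) ⟨Y, hs⟩ (mem_iUnion.2 ⟨n, ?_⟩)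
    rcases tests_eq_some hI with rfl | rfl
    · exact Or.inl rfl
    · exact Or.inr rfl

theorem measurableSet_run (D₀ D₁ δ : ℝ) (useLabels : Bool) (k : ℕ) (s : State) :
    MeasurableSet[coordAlgebra Response (pastQueries k)]
      {Y | run D₀ D₁ δ useLabels Y k = some s} := by
  induction k generalizing s with
  | zero =>
    exact @MeasurableSet.const _ (coordAlgebra Response (pastQueries 0))
      (some ({ queries := 0, left := 0, right := 1 } : State) = some s)
  | succ k ih =>
    have hset : {Y | run D₀ D₁ δ useLabels Y (k + 1) = some s} =
        ⋃ s' ∈ {s | ∃ Y, run D₀ D₁ δ useLabels Y k = some s},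
          {Y | run D₀ D₁ δ useLabels Y k = some s'} ∩
          {Y | oneRound D₀ D₁ δ useLabels (fun i x => Y (k, i, x)) s' = some s} := by
      ext Y
      simp only [mem_iUnion, exists_prop]
      constructor
      · intro hY
        obtain ⟨s', hs, hs'⟩ := Option.bind_eq_some_iff.1 hY
        exact ⟨s', ⟨Y, hs⟩, hs, hs'⟩
      · rintro ⟨s', -, hs, hs'⟩
        exact Option.bind_eq_some_iff.2 ⟨s', hs, hs'⟩
    have hpast : pastQueries k ⊆ pastQueries (k + 1) := fun q hq => Nat.lt_succ_of_lt hq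
    have hround : roundQueries k ⊆ pastQueries (k + 1) := fun q hq =>
      Nat.lt_succ_of_le (le_of_eq hq)
    rw [hset]
    refine MeasurableSet.biUnion (countable_run D₀ D₁ δ useLabels k) fun s' _ => ?_
    refine MeasurableSet.inter ?_ ?_
    · exact coordAlgebra_mono hpast _ (ih s')
    · exact coordAlgebra_mono hround _ (measurableSet_oneRound D₀ D₁ δ useLabels k s' s)

/-- If, from each state that satisfies `Inv`, round `k` fails with probability at most `p`, then the
probability that the actual state before round `k` satisfies `Inv` and the round fails is at most
`p`: condition on the state, which is independent of the responses in round `k`. -/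
theorem measure_run_and_le (D₀ D₁ δ : ℝ) (useLabels : Bool) (P : Labeler) (k : ℕ)
    {Inv : State → Prop} {B : State → Set (ℕ × ℕ × ℝ → Response)} {p : ENNReal}
    (hB : ∀ s, MeasurableSet[coordAlgebra Response (roundQueries k)] (B s))
    (hp : ∀ s, Inv s → responseLaw P (B s) ≤ p) :
    responseLaw P {Y | ∃ s, Inv s ∧ run D₀ D₁ δ useLabels Y k = some s ∧ Y ∈ B s} ≤ p := by
  have hind : Indep (coordAlgebra Response (pastQueries k))
      (coordAlgebra Response (roundQueries k)) (responseLaw P) := by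
    refine indep_coordAlgebra _ (Set.disjoint_left.2 fun q (hq : q.1 < k) (hq' : q.1 = k) => ?_)
    omega
  have : IsProbabilityMeasure (responseLaw P) := by
    unfold responseLaw
    infer_instance
  set R : Set State := {s | Inv s ∧ ∃ Y, run D₀ D₁ δ useLabels Y k = some s} with hR
  have hRc : R.Countable := (countable_run D₀ D₁ δ useLabels k).mono fun s hs => hs.2
  have : Countable R := hRc.to_subtype
  have hsub : {Y | ∃ s, Inv s ∧ run D₀ D₁ δ useLabels Y k = some s ∧ Y ∈ B s} ⊆
      ⋃ s : R, {Y | run D₀ D₁ δ useLabels Y k = some s.1} ∩ B s := by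
    rintro Y ⟨s, hs, hrun, hYB⟩
    exact mem_iUnion.2 ⟨⟨s, hs, Y, hrun⟩, hrun, hYB⟩
  calc _ ≤ ∑' s : R, responseLaw P ({Y | run D₀ D₁ δ useLabels Y k = some s.1} ∩ B s) :=
        (measure_mono hsub).trans (measure_iUnion_le _)
    _ ≤ ∑' s : R, responseLaw P {Y | run D₀ D₁ δ useLabels Y k = some s.1} * p := by
        refine ENNReal.tsum_le_tsum fun s => ?_
        rw [(Indep_iff _ _ _).1 hind _ _ (measurableSet_run D₀ D₁ δ useLabels k s) (hB s)]
        gcongr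
        exact hp s s.2.1
    _ = responseLaw P (⋃ s : R, {Y | run D₀ D₁ δ useLabels Y k = some s.1}) * p := by
        rw [ENNReal.tsum_mul_right, measure_iUnion]
        · intro s t hst
          refine Set.disjoint_left.2 fun Y hs ht => hst (Subtype.ext ?_)
          exact Option.some.inj (hs.symm.trans ht)
        · exact fun s => coordAlgebra_le _ _ (measurableSet_run D₀ D₁ δ useLabels k s)
    _ ≤ 1 * p := by
        gcongr
        exact prob_le_one
    _ = p := one_mul p

/-! ### The number of queries -/

/-- Past a multiple of `L = ln (1 / δ')`, the expected number of answers exceeds the threshold of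
the variance test. -/
theorem exists_gap_constant (D₁ : ℝ) {c : ℝ} (hc : 0 < c) : ∃ A : ℝ, 2 ≤ A ∧
    ∀ z L, 1 ≤ L → A * L ≤ z →
      2 * (|D₁| * devBound (8 * z + 5 * L + 1) L) ≤ c * z := by
  set D := |D₁| + 1 with hD
  have hD1 : 1 ≤ D := by linarith [abs_nonneg D₁]
  obtain ⟨K, hK0, hK⟩ := exists_devBound_le_linear (η := c / (32 * D)) (by positivity)
  set η := c / (32 * D) with hη
  have hη0 : 0 < η := by positivity
  refine ⟨2 + 4 * D * (6 * η + 2 * K) / c, by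
    have : 0 ≤ 4 * D * (6 * η + 2 * K) / c := by positivity
    linarith, fun z L hL hz => ?_⟩
  have h0 : 0 ≤ 4 * D * (6 * η + 2 * K) / c := by positivity
  have hz0 : 0 ≤ z := le_trans (by positivity) hz
  have h1 := hK (8 * z + 5 * L + 1) L (by positivity) (by linarith)
  have h2 : devBound (8 * z + 5 * L + 1) L ≤ 8 * η * z + (6 * η + 2 * K) * L := by nlinarith
  have h3 : 4 * D * ((6 * η + 2 * K) * L) ≤ c * z := by
    have h4 : c * ((2 + 4 * D * (6 * η + 2 * K) / c) * L) =
        2 * c * L + 4 * D * ((6 * η + 2 * K) * L) := by field_simp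
    have h5 : c * ((2 + 4 * D * (6 * η + 2 * K) / c) * L) ≤ c * z := by gcongr
    have h6 : 0 ≤ 2 * c * L := by positivity
    linarith
  have h4 : D * (8 * η * z) = c * z / 4 := by
    rw [hη]
    field_simp
    ring
  have h5 := one_le_devBound (x := 8 * z + 5 * L + 1) (by linarith : 0 ≤ L)
  calc 2 * (|D₁| * devBound (8 * z + 5 * L + 1) L)
      ≤ 2 * (D * (8 * η * z + (6 * η + 2 * K) * L)) := by
        gcongr
        linarith
    _ ≤ c * z := by linarith

theorem two_mul_eq_of_numRounds {ε : ℝ} (hε : 0 < ε) {K : ℕ} (hK : numRounds ε = K) :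
    2 * ε = (3 / 4 : ℝ) ^ K := by
  have h1 : (4 / 3 : ℝ) ^ (numRounds ε) = 1 / (2 * ε) :=
    Real.rpow_logb (by norm_num) (by norm_num) (by positivity)
  rw [hK, Real.rpow_natCast] at h1
  have h2 : (3 / 4 : ℝ) = (4 / 3)⁻¹ := by norm_num
  rw [h2, inv_pow, h1]
  field_simp

theorem numRounds_le {ε : ℝ} (hε : 0 < ε) (hε1 : ε ≤ 1) :
    numRounds ε ≤ 4 * Real.log (1 / ε) := by
  have h1 : (1 / 4 : ℝ) ≤ Real.log (4 / 3) := by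
    have := Real.one_sub_inv_le_log_of_pos (x := 4 / 3) (by norm_num)
    norm_num at this ⊢
    linarith
  have h2 : Real.log (1 / (2 * ε)) ≤ Real.log (1 / ε) := by
    refine Real.log_le_log (by positivity) ?_
    gcongr
    linarith
  have h3 : 0 ≤ Real.log (1 / ε) := log_inv_nonneg hε hε1
  rw [numRounds, Real.logb, div_le_iff₀ (by linarith)]
  nlinarith

/-- Dividing `δ` among the rounds costs only a `ln ln (1 / ε)` term. -/
theorem log_four_mul_numRounds_le {ε : ℝ} (hε : 0 < ε) (hε1 : ε ≤ 1) (hK : 0 < numRounds ε) :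
    Real.log (4 * numRounds ε) ≤ 4 * lnlnPlus (1 / ε) := by
  have h1 := one_le_log_max (1 / ε)
  have h2 := one_le_lnlnPlus (1 / ε)
  have h3 : Real.log (1 / ε) ≤ Real.log (max (1 / ε) (Real.exp (Real.exp 1))) :=
    Real.log_le_log (by positivity) (le_max_left _ _)
  have h4 : 4 * numRounds ε ≤ 2 ^ 4 * Real.log (max (1 / ε) (Real.exp (Real.exp 1))) := by
    have := numRounds_le hε hε1
    linarith
  have h5 := Real.log_two_lt_d9
  calc Real.log (4 * numRounds ε)
      ≤ Real.log (2 ^ 4 * Real.log (max (1 / ε) (Real.exp (Real.exp 1)))) :=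
        Real.log_le_log (by positivity) h4
    _ = 4 * Real.log 2 + lnlnPlus (1 / ε) := by
        rw [Real.log_mul (by norm_num) (by linarith), Real.log_pow]
        rfl
    _ ≤ _ := by linarith

/-- The properties of the state before round `k` that hold as long as no round has failed; each
round has taken at most `N` triples of queries. -/
structure GoodState (N k : ℕ) (θ : ℝ) (s : State) : Prop where
  queries_le : s.queries ≤ 3 * N * k
  width : s.right - s.left = (3 / 4) ^ k
  left_le : s.left ≤ θ
  le_right : θ ≤ s.right
  left_nonneg : 0 ≤ s.left
  right_le_one : s.right ≤ 1

theorem GoodState.left_lt_right {N k : ℕ} {θ : ℝ} {s : State} (h : GoodState N k θ s) :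
    s.left < s.right := by
  have := h.width
  have : (0 : ℝ) < (3 / 4) ^ k := by positivity
  linarith

theorem exists_run_eq {D₀ D₁ δ θ : ℝ} {useLabels : Bool} {Y : ℕ × ℕ × ℝ → Response} {N K : ℕ}
    (hθ : θ ∈ Icc (0 : ℝ) 1)
    (hstep : ∀ k < K, ∀ s, GoodState N k θ s → run D₀ D₁ δ useLabels Y k = some s →
      ∃ s', oneRound D₀ D₁ δ useLabels (fun i x => Y (k, i, x)) s = some s' ∧
        s'.queries ≤ s.queries + 3 * N ∧ s'.right - s'.left = 3 / 4 * (s.right - s.left) ∧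
        s'.left ≤ θ ∧ θ ≤ s'.right ∧ 0 ≤ s'.left ∧ s'.right ≤ 1) :
    ∀ k ≤ K, ∃ s, run D₀ D₁ δ useLabels Y k = some s ∧ GoodState N k θ s := by
  intro k
  induction k with
  | zero =>
    exact fun _ => ⟨_, rfl, ⟨by simp, by simp, hθ.1, hθ.2, le_rfl, le_rfl⟩⟩
  | succ k ih =>
    intro hk
    obtain ⟨s, hs, hgood⟩ := ih (by omega)
    obtain ⟨s', hs', hq, hw, hl, hr, h0, h1⟩ := hstep k (by omega) s hgood hs
    refine ⟨s', Option.bind_eq_some_iff.2 ⟨s, hs, hs'⟩, ⟨?_, ?_, hl, hr, h0, h1⟩⟩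
    · have := hgood.queries_le
      rw [Nat.mul_succ]
      omega
    · rw [hw, hgood.width, pow_succ]
      ring

theorem abs_midpoint_sub_le {ε θ : ℝ} {N K : ℕ} {s : State} (h : GoodState N K θ s)
    (hε : 2 * ε = (3 / 4) ^ K) : |(s.left + s.right) / 2 - θ| ≤ ε := by
  have h1 := h.width
  have h2 := h.left_le
  have h3 := h.le_right
  exact abs_le.2 ⟨by linarith, by linarith⟩

/-- The guarantee for the algorithm when it makes at least one round, with a constant `A` such that
`A * ln (1 / δ')` expected answers suffice for the variance test. -/
theorem algorithm_guarantee {D₀ D₁ : ℝ} (hD₀ : IsUniformConst D₀)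
    (hD₁ : IsUniformEmpiricalConst D₁) {c : ℝ} (hc : 0 < c) {A : ℝ} (hA : 2 ≤ A)
    (hgap : ∀ z L, 1 ≤ L → A * L ≤ z →
      2 * (|D₁| * devBound (8 * z + 5 * L + 1) L) ≤ c * z)
    {f : ℝ → ℝ} {θ : ℝ} {P : Labeler} (hf : NotTooFlat c f) (hθ : θ ∈ Icc (0 : ℝ) 1)
    (hP : MonotoneAbstention P θ) (hPf : AbstentionRate P f θ) {ε δ : ℝ} (hε : 0 < ε)
    (hδ : 0 < δ) (hδ1 : δ < 1) {K : ℕ} (hK : numRounds ε = K) (hK0 : 0 < K) (useLabels : Bool) :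
    1 - δ ≤ (responseLaw P).real {Y | ∃ (T : ℕ) (θhat : ℝ),
      algorithm D₀ D₁ ε δ useLabels Y = some (T, θhat) ∧
      (T : ℝ) ≤ 96 * A * (1 / f (ε / 2)) * Real.log (1 / ε) *
        (Real.log (1 / δ) + lnlnPlus (1 / ε)) ∧
      |θhat - θ| ≤ ε} := by
  have hε2 := two_mul_eq_of_numRounds hε hK
  have hpow1 : (3 / 4 : ℝ) ^ K ≤ 1 := pow_le_one₀ (by norm_num) (by norm_num)
  have hε1 : ε ≤ 1 := by linarith
  have hK1 : (1 : ℝ) ≤ K := by exact_mod_cast hK0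
  have hF0 := hf.pos (ε / 2) (by linarith) (by linarith)
  have hF1 := (hf.mapsTo (x := ε / 2) ⟨by linarith, by linarith⟩).2
  set F₀ := f (ε / 2) with hF₀
  set δ' := δ / (4 * K) with hδ'
  have hδ'0 : 0 < δ' := by positivity
  have hδ'1 : δ' < 1 := by
    rw [hδ', div_lt_one (by positivity)]
    linarith
  have hlogδ := log_inv_nonneg hδ hδ1.le
  have hlogε := log_inv_nonneg hε hε1
  set L := Real.log (1 / δ') with hL
  have hLeq : L = Real.log (1 / δ) + Real.log (4 * K) := log_inv_div hδ (by positivity)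
  have hL1 : 1 ≤ L := by
    have h1 : Real.log (2 ^ 2) ≤ Real.log (4 * K) :=
      Real.log_le_log (by norm_num) (by linarith)
    rw [Real.log_pow] at h1
    have := Real.log_two_gt_d9
    push_cast at h1
    linarith
  have hLle : L ≤ 4 * (Real.log (1 / δ) + lnlnPlus (1 / ε)) := by
    have := log_four_mul_numRounds_le hε hε1 (by rw [hK]; positivity)
    rw [hK] at this
    linarith
  -- the number of triples of queries that suffices in every round
  set N := ⌈A * L / F₀⌉₊ with hNdef
  have hNge : A * L / F₀ ≤ N := Nat.le_ceil _
  have hAL : 2 ≤ A * L := by nlinarith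
  have hALF : A * L ≤ A * L / F₀ := by
    rw [le_div_iff₀ hF0]
    nlinarith
  have hNF : ∀ F, F₀ ≤ F → A * L ≤ N * F := fun F hF => by
    rw [div_le_iff₀ hF0] at hNge
    exact hNge.trans (by gcongr)
  have hN2 : 2 ≤ N := by
    have : (2 : ℝ) ≤ N := by linarith
    exact_mod_cast this
  have hNle : (N : ℝ) ≤ 2 * (A * L / F₀) := by
    have := (Nat.ceil_lt_add_one (a := A * L / F₀) (by linarith)).le
    rw [← hNdef] at this
    linarith
  have hLN : L ≤ N := by nlinarith
  set a : ℝ → ℝ := fun x => 1 - (P x none).toReal with ha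
  have ha' : ∀ x ∈ Icc (0 : ℝ) 1, a x = f |x - θ| := fun x hx => by
    rw [ha]
    simp only
    rw [hPf x hx]
    ring
  set bad : ℕ → Set (ℕ × ℕ × ℝ → Response) := fun k =>
    {Y | ∃ s, GoodState N k θ s ∧ run D₀ D₁ δ' useLabels Y k = some s ∧
      Y ∈ {Y | RoundBad D₀ D₁ δ' θ a s.left s.right (fun i x => Y (k, i, x))}} with hbad
  have hbadk : ∀ k, responseLaw P (bad k) ≤ ENNReal.ofReal (4 * δ') := fun k =>
    measure_run_and_le D₀ D₁ δ' useLabels P k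
      (fun s => measurableSet_roundBad k D₀ D₁ δ' θ a s.left s.right)
      fun s hs => measure_roundBad_le hD₀ hD₁ hf hP hPf k hs.left_nonneg hs.right_le_one
        hs.left_lt_right hs.left_le hs.le_right hδ'0 hδ'1
  have : IsProbabilityMeasure (responseLaw P) := by
    unfold responseLaw
    infer_instance
  refine one_sub_le_measureReal hδ.le (B := ⋃ k ∈ Finset.range K, bad k) ?_ ?_
  · intro Y hY
    by_contra hcon
    simp only [mem_iUnion, not_exists, Finset.mem_range] at hcon
    refine hY ?_
    obtain ⟨s, hs, hgood⟩ := exists_run_eq (D₀ := D₀) (D₁ := D₁) (δ := δ')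
      (useLabels := useLabels) (Y := Y) (N := N) (K := K) hθ (fun k hk s hgood hs => by
        refine exists_oneRound_eq hf hc ha' hδ'0 hδ'1.le hgood.left_nonneg hgood.right_le_one
          hgood.left_lt_right hgood.left_le hgood.le_right hN2 hLN (F₀ := F₀) ?_ ?_ useLabels
          fun hb => hcon k hk ⟨s, hgood, hs, hb⟩
        · intro b hb hb1
          -- the interval has width at least `2 * ε`, so `ε / 2` is at most a quarter of it
          have h1 : (3 / 4 : ℝ) ^ K ≤ (3 / 4) ^ k :=
            pow_le_pow_of_le_one (by norm_num) (by norm_num) hk.le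
          rw [hgood.width] at hb
          have h2 : ε / 2 ≤ b := by linarith
          exact hf.monotone ⟨by linarith, by linarith⟩ ⟨by linarith, hb1⟩ h2
        · intro F hF _
          exact hgap _ _ hL1 (hNF F hF)) K le_rfl
    refine ⟨s.queries, (s.left + s.right) / 2, ?_, ?_, abs_midpoint_sub_le hgood hε2⟩
    · rw [algorithm, hK, Nat.floor_natCast, ← hδ', hs]
      rfl
    · have h1 : (s.queries : ℝ) ≤ 3 * N * K := by exact_mod_cast hgood.queries_le
      have h2 : (K : ℝ) ≤ 4 * Real.log (1 / ε) := hK ▸ numRounds_le hε hε1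
      have h3 := one_le_lnlnPlus (1 / ε)
      calc (s.queries : ℝ) ≤ 3 * N * K := h1
        _ ≤ 3 * (2 * (A * (4 * (Real.log (1 / δ) + lnlnPlus (1 / ε))) / F₀)) *
            (4 * Real.log (1 / ε)) := by
            gcongr
            exact hNle.trans (by gcongr)
        _ = _ := by ring
  · refine (measure_biUnion_finset_le _ _).trans ((Finset.sum_le_sum fun k _ => hbadk k).trans ?_)
    rw [Finset.sum_const, Finset.card_range, nsmul_eq_mul, ← ENNReal.ofReal_natCast,
      ← ENNReal.ofReal_mul (by positivity)]
    refine ENNReal.ofReal_le_ofReal (le_of_eq ?_)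
    rw [hδ']
    field_simp

/-- Without rounds, the algorithm outputs `1 / 2`, which is within `ε = 1 / 2` of `θ`. -/
theorem algorithm_guarantee_zero {D₀ D₁ C c : ℝ} (hC : 0 ≤ C) {f : ℝ → ℝ} {θ : ℝ} {P : Labeler}
    (hf : NotTooFlat c f) (hθ : θ ∈ Icc (0 : ℝ) 1) {ε δ : ℝ} (hε : 0 < ε) (hδ : 0 < δ)
    (hδ1 : δ < 1) (hK : numRounds ε = (0 : ℕ)) (useLabels : Bool) :
    1 - δ ≤ (responseLaw P).real {Y | ∃ (T : ℕ) (θhat : ℝ),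
      algorithm D₀ D₁ ε δ useLabels Y = some (T, θhat) ∧
      (T : ℝ) ≤ C * (1 / f (ε / 2)) * Real.log (1 / ε) *
        (Real.log (1 / δ) + lnlnPlus (1 / ε)) ∧
      |θhat - θ| ≤ ε} := by
  have hε2 := two_mul_eq_of_numRounds hε hK
  rw [pow_zero] at hε2
  have : IsProbabilityMeasure (responseLaw P) := by
    unfold responseLaw
    infer_instance
  refine one_sub_le_measureReal hδ.le (B := ∅) ?_ (by simp)
  intro Y hY
  refine hY ⟨0, (0 + 1) / 2, ?_, ?_, ?_⟩
  · rw [algorithm, hK, Nat.floor_natCast]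
    rfl
  · have h1 := hf.pos (ε / 2) (by linarith) (by linarith)
    have h2 := log_inv_nonneg hδ hδ1.le
    have h3 := log_inv_nonneg hε (by linarith : ε ≤ 1)
    have h4 := one_le_lnlnPlus (1 / ε)
    rw [Nat.cast_zero]
    positivity
  · exact abs_le.2 ⟨by linarith [hθ.2], by linarith [hθ.1]⟩

end

end AbstainingLabeler

open AbstainingLabeler in
theorem mainTheorem2 :
    (∃ D₀ : ℝ, IsUniformConst D₀) ∧ (∃ D₁ : ℝ, IsUniformEmpiricalConst D₁) ∧
    ∀ D₀ D₁ : ℝ, IsUniformConst D₀ → IsUniformEmpiricalConst D₁ →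
      ∀ c : ℝ, 0 < c → c < 1 → ∃ C : ℝ, 0 < C ∧
        ∀ (f : ℝ → ℝ) (θ : ℝ) (P : Labeler), NotTooFlat c f → θ ∈ Set.Icc (0 : ℝ) 1 →
          MonotoneAbstention P θ → AbstentionRate P f θ →
          ∀ ε δ : ℝ, 0 < ε → 0 < δ → δ < 1 → (∃ K : ℕ, numRounds ε = K) →
            ∀ useLabels : Bool,
              1 - δ ≤ (responseLaw P).real {Y | ∃ (T : ℕ) (θhat : ℝ),
                algorithm D₀ D₁ ε δ useLabels Y = some (T, θhat) ∧
                (T : ℝ) ≤ C * (1 / f (ε / 2)) * Real.log (1 / ε) *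
                  (Real.log (1 / δ) + lnlnPlus (1 / ε)) ∧
                |θhat - θ| ≤ ε} := by
  refine ⟨exists_isUniformConst, exists_isUniformEmpiricalConst,
    fun D₀ D₁ hD₀ hD₁ c hc _ => ?_⟩
  obtain ⟨A, hA, hgap⟩ := exists_gap_constant D₁ hc
  refine ⟨96 * A, by linarith, fun f θ P hf hθ hP hPf ε δ hε hδ hδ1 hK useLabels => ?_⟩
  obtain ⟨K, hK⟩ := hK
  rcases K.eq_zero_or_pos with rfl | hK0
  · exact algorithm_guarantee_zero (by linarith) hf hθ hε hδ hδ1 hK useLabels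
  · exact algorithm_guarantee hD₀ hD₁ hc hA hgap hf hθ hP hPf hε hδ hδ1 hK hK0 useLabels
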